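/- **Theorem 1.** Let $K\subset\mathbb{R}^n$ be an origin-symmetric star body with $C^\infty$ boundary: $K$ is compact, star-shaped with respect to the origin, $K=-K$, and its radial function $\rho_K(x)=\max\{a>0: ax\in K\}$, $x\neq 0$, is positive and infinitely differentiable on $\mathbb{R}^n\setminus\{0\}$. For $\xi\in S^{n-1}$ let $A_\xi(z)=\mathrm{vol}_{n-1}(K\cap(\xi^\perp+z\xi))$, $z\in\mathbb{R}$, be the parallel section function of $K$. Let $k\ge 0$ be an integer with $k\neq n-1$. Then: The function $\rho_K^{\,n-k-1}$ defines, by integration, a tempered distribution on $\mathbb{R}^n$. Let $(\rho_K^{\,n-k-1})^\wedge$ be its Fourier transform, where $\langle \hat f,\varphi\rangle=\langle f,\hat\varphi\rangle$ and $\hat\varphi(x)=\int_{\mathbb{R}^n}\varphi(y)e^{-i\langle y,x\rangle}\,dy$ for Schwartz functions $\varphi$. On $\mathbb{R}^n\setminus\{0\}$ this distribution is a continuous function (that is, it acts by integration against this function on Schwartz functions vanishing near $0$), and if $k<n-1$ it is given by integration against this function on all Schwartz functions. For every $\xi\in S^{n-1}$ the function $A_\xi$ is infinitely differentiable at $0$,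 and the value of $(\rho_K^{\,n-k-1})^\wedge$ at $\xi$ is as follows. (a) If $k$ is even, then $$(\rho_K^{\,n-k-1})^\wedge(\xi)=(-1)^{k/2}\,\pi\,(n-k-1)\,A_\xi^{(k)}(0).$$ (b) If $k$ is odd, then $$(\rho_K^{\,n-k-1})^\wedge(\xi)=c_k\int_0^\infty \frac{A_\xi(z)-\sum_{j=0}^{(k-1)/2}A_\xi^{(2j)}(0)\,\frac{z^{2j}}{(2j)!}}{z^{k+1}}\,dz,\qquad c_k=(-1)^{(k+1)/2}\,2\,(n-1-k)\,k!,$$ where the integral converges absolutely. -/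

import Mathlib

open MeasureTheory SchwartzMap FourierTransform
open scoped ContDiff InnerProductSpace

noncomputable section

namespace StarBody

/-- The radial function `ρ_K(x) = max {a > 0 : a x ∈ K}`, for `x ≠ 0`. -/
def radialFunction {n : ℕ} (K : Set (EuclideanSpace ℝ (Fin n)))
    (x : EuclideanSpace ℝ (Fin n)) : ℝ :=
  sSup {a : ℝ | 0 < a ∧ a • x ∈ K}

/-- A star body: a compact set, star-shaped with respect to the origin, whose radial function is
positive and continuous on the unit sphere.  (Compactness makes the supremum in `radialFunction`
a maximum; positivity makes the set whose supremum is taken nonempty.) -/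
structure IsStarBody {n : ℕ} (K : Set (EuclideanSpace ℝ (Fin n))) : Prop where
  isCompact : IsCompact K
  starConvex : StarConvex ℝ 0 K
  radial_pos : ∀ x ∈ Metric.sphere (0 : EuclideanSpace ℝ (Fin n)) 1, 0 < radialFunction K x
  radial_continuousOn :
    ContinuousOn (radialFunction K) (Metric.sphere (0 : EuclideanSpace ℝ (Fin n)) 1)

/-- A star body has `C^∞` boundary if its radial function is infinitely differentiable on
`ℝⁿ ∖ {0}` (equivalently, since it is homogeneous of degree `-1`, on the unit sphere); the boundary
is then the smooth radial graph `{x : ρ_K(x) = 1}`. -/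
def HasSmoothBoundary {n : ℕ} (K : Set (EuclideanSpace ℝ (Fin n))) : Prop :=
  ContDiffOn ℝ ∞ (radialFunction K) {0}ᶜ

/-- The parallel section function `A_ξ(z) = vol_{n-1}(K ∩ (ξ^⊥ + z ξ))` for a unit vector `ξ`:
the section is translated by `-z ξ` into the hyperplane `ξ^⊥`, which carries its own
`(n-1)`-dimensional Lebesgue measure. -/
def parallelSection {n : ℕ} (K : Set (EuclideanSpace ℝ (Fin n)))
    (ξ : EuclideanSpace ℝ (Fin n)) (z : ℝ) : ℝ :=
  (volume : Measure ((ℝ ∙ ξ)ᗮ : Submodule ℝ (EuclideanSpace ℝ (Fin n)))).real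
    {y | (y : EuclideanSpace ℝ (Fin n)) + z • ξ ∈ K}

/-- The dilation `x ↦ (2π)⁻¹ x`. -/
def dilation (n : ℕ) : EuclideanSpace ℝ (Fin n) ≃L[ℝ] EuclideanSpace ℝ (Fin n) :=
  ContinuousLinearEquiv.smulLeft (Units.mk0 ((2 * Real.pi)⁻¹ : ℝ) (by positivity))

/-- The Fourier transform `φ^(x) = ∫ φ(y) exp(-i⟨y, x⟩) dy` of Schwartz functions
(see `fourierTest_apply`). -/
def fourierTest (n : ℕ) :
    𝓢(EuclideanSpace ℝ (Fin n), ℂ) →L[ℂ] 𝓢(EuclideanSpace ℝ (Fin n), ℂ) :=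
  (SchwartzMap.compCLMOfContinuousLinearEquiv ℂ (dilation n)).comp
    (fourierCLM ℂ 𝓢(EuclideanSpace ℝ (Fin n), ℂ))

theorem fourierTest_apply (n : ℕ) (φ : 𝓢(EuclideanSpace ℝ (Fin n), ℂ))
    (x : EuclideanSpace ℝ (Fin n)) :
    fourierTest n φ x = ∫ y, Complex.exp (-Complex.I * (⟪y, x⟫_ℝ : ℂ)) * φ y := by
  have h : fourierTest n φ x = 𝓕 (φ : EuclideanSpace ℝ (Fin n) → ℂ) ((2 * Real.pi)⁻¹ • x) := rfl
  rw [h, Real.fourier_eq']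
  refine integral_congr_ae (Filter.Eventually.of_forall fun y => ?_)
  have hpi : (Real.pi : ℂ) ≠ 0 := by exact_mod_cast Real.pi_ne_zero
  simp only [smul_eq_mul, real_inner_smul_right]
  congr 2
  push_cast
  field_simp

/-- The Fourier transform of a tempered distribution, `⟨T^, φ⟩ = ⟨T, φ^⟩`. -/
def fourierDistribution {n : ℕ} (T : 𝓢'(EuclideanSpace ℝ (Fin n), ℂ)) :
    𝓢'(EuclideanSpace ℝ (Fin n), ℂ) :=
  PointwiseConvergenceCLM.precomp ℂ (fourierTest n) T

theorem fourierDistribution_apply {n : ℕ} (T : 𝓢'(EuclideanSpace ℝ (Fin n), ℂ))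
    (φ : 𝓢(EuclideanSpace ℝ (Fin n), ℂ)) :
    fourierDistribution T φ = T (fourierTest n φ) := rfl

/-- The tempered distribution `T` is (given by integration against) the function `f`. -/
def IsGivenBy {n : ℕ} (T : 𝓢'(EuclideanSpace ℝ (Fin n), ℂ))
    (f : EuclideanSpace ℝ (Fin n) → ℝ) : Prop :=
  ∀ φ : 𝓢(EuclideanSpace ℝ (Fin n), ℂ),
    Integrable (fun x => (f x : ℂ) * φ x) ∧ T φ = ∫ x, (f x : ℂ) * φ x

/-- The tempered distribution `T` is, on `ℝⁿ ∖ {0}`, the function `f`: the identity is tested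
with Schwartz functions that vanish in a neighbourhood of the origin. -/
def IsGivenByOffZero {n : ℕ} (T : 𝓢'(EuclideanSpace ℝ (Fin n), ℂ))
    (f : EuclideanSpace ℝ (Fin n) → ℝ) : Prop :=
  ∀ φ : 𝓢(EuclideanSpace ℝ (Fin n), ℂ), (0 : EuclideanSpace ℝ (Fin n)) ∉ tsupport φ →
    Integrable (fun x => (f x : ℂ) * φ x) ∧ T φ = ∫ x, (f x : ℂ) * φ x

end StarBody

end

/-!
# The Fourier transform of powers of the radial function and parallel sections

Write `ρ = ρ_K`. The power `ρ ^ (n - k - 1)` is homogeneous of degree `k + 1 - n` and smooth away from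
the origin. It is written as a superposition of dilates of one test function: for a smooth `H ≥ 0`
supported in `[1, 2]` put `χ(x) = H(ρ(x))`, which is smooth, even, and supported in a shell around the
origin. Then
`c ρ(x) ^ (n - k - 1) = ∫₀^∞ t ^ (k - n) χ(x / t) dt` with `c = ∫₀^∞ t ^ (k - n) H(t) dt > 0`
(`integral_zpow_mul_radialProfile`). Taking Fourier transforms under the integral sign gives the
function `g(y) = c⁻¹ ∫₀^∞ t ^ k χ^(t y) dt` (`transformFunction`). As `χ^` decays rapidly, `g` is
continuous off the origin and bounded by a multiple of `|y| ^ (-k-1)`; Fubini's theorem applies to all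
test functions `φ` for which `|y| ^ (-k-1) φ` is integrable, hence to those vanishing near the origin,
and to all of them if `k + 1 < n` (`integral_radialFunction_zpow_mul_fourierTest`).

For a unit vector `ξ`, the value `c g(ξ)` is the `k`-th moment of `t ↦ χ^(t ξ)`. Let
`B(z) = ∫ χ` over the hyperplane `ξ^⊥ + z ξ`. There are two formulas for `B`:
* Fourier inversion on the line `ℝ ξ` writes `B` as a superposition of the functions `cos(t z)` with
  weight `π⁻¹ χ^(t ξ)`, `t > 0` (`sectionIntegral_eq_integral_cosTransform`);
* slicing `χ` by the dilates of `K` writes `B` as a superposition of the functions `A_ξ(v z)` with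
  weight `H'(v) v ^ (1 - n)` (`sectionIntegral_radialProfile`); by an integration by parts the `k`-th
  moment of this weight is `(n - k - 1) c`.
For a superposition of dilates of one even function `φ`, both the `k`-th derivative at `0` and, for odd
`k`, the regularized integral of `φ(z) z ^ (-k-1)` are the `k`-th moment of the weight times the same
quantity for `φ` (`iteratedDeriv_superposition`, `integral_taylorQuotient_superposition`). Comparing
the two formulas yields (a) and (b); the regularized integral of the cosine comes from the Laplace
transform (`integral_taylorQuotient_cos`).

It remains to see that `A_ξ` is smooth near `0` (`exists_contDiffOn_parallelSection`). In polar
coordinates of `ξ^⊥`, the boundary point of the section in the direction `θ` is found by solving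
`w ρ(θ + w ξ) = z` for the slope `w`, and the left side is increasing for small `w`. So `A_ξ(z)` is an
integral over the sphere of a smooth function of `θ` and of the solution `w(θ, z)`.
-/

namespace StarBody

/-! ### Differentiation under the integral sign -/

theorem natCast_le_infty (m : ℕ) : (m : WithTop ℕ∞) ≤ ∞ := by exact_mod_cast le_top

/-- If `F (j + 1)` is the derivative of `F j` in the parameter and each `F j` is dominated by an
integrable function, the same relation holds for the integrals. -/
theorem hasDerivAt_integral_family {X : Type*} [MeasurableSpace X] {μ : Measure X} {a : ℝ}
    (F : ℕ → ℝ → X → ℝ) (bound : ℕ → X → ℝ)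
    (hmeas : ∀ j z, |z| < a → AEStronglyMeasurable (F j z) μ)
    (hbound : ∀ j, ∀ᵐ x ∂μ, ∀ z, |z| < a → |F j z x| ≤ bound j x)
    (hint : ∀ j, Integrable (bound j) μ)
    (hder : ∀ j, ∀ᵐ x ∂μ, ∀ z, |z| < a → HasDerivAt (fun z => F j z x) (F (j + 1) z x) z)
    (j : ℕ) (z : ℝ) (hz : |z| < a) :
    HasDerivAt (fun z => ∫ x, F j z x ∂μ) (∫ x, F (j + 1) z x ∂μ) z := by
  have hopen : IsOpen {z : ℝ | |z| < a} := isOpen_lt continuous_abs continuous_const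
  have hnhds : {z : ℝ | |z| < a} ∈ nhds z := hopen.mem_nhds hz
  refine (hasDerivAt_integral_of_dominated_loc_of_deriv_le hnhds ?_ ?_ (hmeas (j + 1) z hz)
    (hbound (j + 1)) (hint (j + 1)) (hder j)).2
  · filter_upwards [hnhds] with y hy using hmeas j y hy
  · refine (hint j).mono' (hmeas j z hz) ?_
    filter_upwards [hbound j] with x hx using hx z hz

theorem iteratedDeriv_eq_of_hasDerivAt {I : ℕ → ℝ → ℝ} {a : ℝ}
    (h : ∀ j z, |z| < a → HasDerivAt (I j) (I (j + 1) z) z) (j : ℕ) :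
    ∀ z, |z| < a → iteratedDeriv j (I 0) z = I j z := by
  have hopen : IsOpen {z : ℝ | |z| < a} := isOpen_lt continuous_abs continuous_const
  induction j with
  | zero => intro z _; simp
  | succ j ih =>
    intro z hz
    rw [iteratedDeriv_succ]
    have : iteratedDeriv j (I 0) =ᶠ[nhds z] I j := by
      filter_upwards [hopen.mem_nhds hz] with y hy using ih y hy
    rw [this.deriv_eq, (h j z hz).deriv]

theorem contDiffOn_of_hasDerivAt {I : ℕ → ℝ → ℝ} {a : ℝ}
    (h : ∀ j z, |z| < a → HasDerivAt (I j) (I (j + 1) z) z) :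
    ContDiffOn ℝ ∞ (I 0) {z | |z| < a} := by
  have hopen : IsOpen {z : ℝ | |z| < a} := isOpen_lt continuous_abs continuous_const
  have key : ∀ m : ℕ, ∀ j, ContDiffOn ℝ m (I j) {z | |z| < a} := by
    intro m
    induction m with
    | zero =>
      intro j
      rw [Nat.cast_zero, contDiffOn_zero]
      exact fun z hz => (h j z hz).continuousAt.continuousWithinAt
    | succ m ih =>
      intro j
      rw [Nat.cast_succ, contDiffOn_succ_iff_deriv_of_isOpen hopen]
      refine ⟨fun z hz => (h j z hz).differentiableAt.differentiableWithinAt, by simp, ?_⟩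
      exact (ih (j + 1)).congr fun z hz => (h j z hz).deriv
  exact contDiffOn_infty.2 fun m => key m 0

/-! ### The regularized integral of a function that is even and smooth near zero -/

/-- The quotient `(φ(z) - ∑_{2j < k} φ^{(2j)}(0) z^{2j} / (2j)!) / z^{k+1}`, whose integral over
`(0, ∞)` is, for odd `k`, the regularization of `∫ φ(z) z^{-k-1} dz`. -/
noncomputable def taylorQuotient (φ : ℝ → ℝ) (k : ℕ) (z : ℝ) : ℝ :=
  (φ z - ∑ j ∈ Finset.range ((k + 1) / 2),
    iteratedDeriv (2 * j) φ 0 * z ^ (2 * j) / ((2 * j).factorial : ℝ)) / z ^ (k + 1)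

theorem measurable_taylorQuotient {φ : ℝ → ℝ} (hφ : Measurable φ) (k : ℕ) :
    Measurable (taylorQuotient φ k) := by
  unfold taylorQuotient
  fun_prop

theorem iteratedDeriv_zero_of_even_of_odd {φ : ℝ → ℝ} (heven : ∀ z, φ (-z) = φ z) {i : ℕ}
    (hi : Odd i) : iteratedDeriv i φ 0 = 0 := by
  have h := iteratedDeriv_comp_neg i φ 0
  simp only [heven, neg_zero, hi.neg_one_pow, smul_eq_mul] at h
  linarith

theorem sum_range_even_of_odd_eq_zero (m : ℕ) (f : ℕ → ℝ) (h : ∀ i, Odd i → f i = 0) :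
    ∑ i ∈ Finset.range (2 * m), f i = ∑ j ∈ Finset.range m, f (2 * j) := by
  induction m with
  | zero => simp
  | succ m ih =>
    rw [show 2 * (m + 1) = 2 * m + 1 + 1 by ring, Finset.sum_range_succ, Finset.sum_range_succ,
      ih, Finset.sum_range_succ, h (2 * m + 1) ⟨m, rfl⟩, add_zero]

/-- Near zero Taylor's theorem bounds the quotient, as the odd derivatives of an even function
vanish and the sum is its Taylor polynomial of degree `k`; at infinity it is `O(z ^ (-2))`. -/
theorem integrableOn_taylorQuotient {φ : ℝ → ℝ} (hφ : Measurable φ) {C : ℝ}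
    (hC : ∀ z, |φ z| ≤ C) (heven : ∀ z, φ (-z) = φ z) (hsmooth : ContDiffAt ℝ ∞ φ 0)
    {k : ℕ} (hk : Odd k) : IntegrableOn (taylorQuotient φ k) (Set.Ioi 0) := by
  obtain ⟨m, rfl⟩ := hk
  have hm : (2 * m + 1 + 1) / 2 = m + 1 := by omega
  obtain ⟨u, hu, hφu⟩ : ∃ u ∈ nhds (0 : ℝ), ContDiffOn ℝ ((2 * m + 1 : ℕ) + 1) φ u := by
    generalize 2 * m + 1 = p
    have h1 : ContDiffAt ℝ (p + 1 : ℕ) φ 0 := hsmooth.of_le (natCast_le_infty _)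
    obtain ⟨u, hu, h2⟩ := h1.contDiffOn le_rfl fun h => absurd h (by exact_mod_cast WithTop.natCast_ne_top (p + 1))
    exact ⟨u, by simpa using hu, by exact_mod_cast h2⟩
  obtain ⟨b, hb, hbu⟩ := Metric.nhds_basis_closedBall.mem_iff.1 hu
  have hsub : Set.Icc 0 b ⊆ u := fun x hx => hbu (by
    simp only [Metric.mem_closedBall, Real.dist_eq, sub_zero]; rw [abs_of_nonneg hx.1]; exact hx.2)
  obtain ⟨M, hM⟩ := exists_taylor_mean_remainder_bound hb.le (hφu.mono hsub)
  have htaylor : ∀ z, taylorWithinEval φ (2 * m + 1) (Set.Icc 0 b) 0 z =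
      ∑ j ∈ Finset.range (m + 1), iteratedDeriv (2 * j) φ 0 * z ^ (2 * j) /
        ((2 * j).factorial : ℝ) := by
    intro z
    rw [taylor_within_apply, show 2 * m + 1 + 1 = 2 * (m + 1) by ring]
    have hd : ∀ i, iteratedDerivWithin i φ (Set.Icc 0 b) 0 = iteratedDeriv i φ 0 := fun i =>
      iteratedDerivWithin_eq_iteratedDeriv (uniqueDiffOn_Icc hb)
        (hsmooth.of_le (by exact_mod_cast le_top)) (Set.left_mem_Icc.2 hb.le)
    rw [sum_range_even_of_odd_eq_zero]
    · refine Finset.sum_congr rfl fun j _ => ?_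
      rw [hd, sub_zero, smul_eq_mul]; ring
    · intro i hi
      rw [hd, iteratedDeriv_zero_of_even_of_odd heven hi, smul_zero]
  have hmeas := measurable_taylorQuotient hφ (2 * m + 1)
  rw [← Set.Ioc_union_Ioi_eq_Ioi hb.le]
  refine IntegrableOn.union ?_ ?_
  · refine Measure.integrableOn_of_bounded (M := M) (by simp) hmeas.aestronglyMeasurable ?_
    refine (ae_restrict_iff' measurableSet_Ioc).2 (Filter.Eventually.of_forall fun z hz => ?_)
    have h := hM z ⟨hz.1.le, hz.2⟩
    have hz0 : 0 < z ^ (2 * m + 1 + 1) := pow_pos hz.1 _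
    rw [htaylor, sub_zero] at h
    rw [taylorQuotient, hm, norm_div, Real.norm_of_nonneg hz0.le, div_le_iff₀ hz0]
    exact h
  · have hpow : ∀ p : ℕ, 2 ≤ p → IntegrableOn (fun z : ℝ => (z ^ p)⁻¹) (Set.Ioi b) := by
      intro p hp
      refine (integrableOn_Ioi_rpow_of_lt (a := -(p : ℝ)) ?_ hb).congr_fun (fun z hz => ?_)
        measurableSet_Ioi
      · have : (2 : ℝ) ≤ p := by exact_mod_cast hp
        linarith
      · simp only [Real.rpow_neg (hb.trans hz).le, Real.rpow_natCast]
    have hexp : Set.EqOn (fun z => φ z * (z ^ (2 * m + 1 + 1))⁻¹ - ∑ j ∈ Finset.range (m + 1),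
        iteratedDeriv (2 * j) φ 0 / ((2 * j).factorial : ℝ) * (z ^ (2 * m + 2 - 2 * j))⁻¹)
        (taylorQuotient φ (2 * m + 1)) (Set.Ioi b) := by
      intro z hz
      have hz0 : z ≠ 0 := (hb.trans hz).ne'
      simp only [taylorQuotient, hm, sub_div, Finset.sum_div]
      rw [div_eq_mul_inv (φ z)]
      congr 1
      refine Finset.sum_congr rfl fun j hj => ?_
      have hj' : 2 * j ≤ 2 * m + 2 := by have := Finset.mem_range.1 hj; omega
      rw [show z ^ (2 * m + 1 + 1) = z ^ (2 * j) * z ^ (2 * m + 2 - 2 * j) by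
        rw [← pow_add]; congr 1; omega]
      field_simp
    refine IntegrableOn.congr_fun ?_ hexp measurableSet_Ioi
    refine Integrable.sub ?_ ?_
    · exact (hpow _ (by omega)).bdd_mul hφ.aestronglyMeasurable
        (Filter.Eventually.of_forall fun z => hC z)
    · refine integrable_finsetSum _ fun j hj => ?_
      have hj' := Finset.mem_range.1 hj
      exact (hpow _ (by omega)).const_mul _

/-! ### Superpositions of dilates of one function -/

/-- The derivatives at `0` of a superposition `∫ w(x) φ(s(x) z) dμ(x)` of dilates of `φ`. The set `D`
is a neighbourhood of `0` on which `φ` is smooth, and contains all points `s(x) z`, `|z| < a`. -/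
theorem iteratedDeriv_superposition {X : Type*} [MeasurableSpace X] {μ : Measure X}
    {w s : X → ℝ} {φ : ℝ → ℝ} {D : Set ℝ} {a : ℝ} {C : ℕ → ℝ} (ha : 0 < a) (hφ : Measurable φ)
    (hD : IsOpen D) (hφD : ContDiffOn ℝ ∞ φ D)
    (hC : ∀ j, ∀ v ∈ D, |iteratedDeriv j φ v| ≤ C j)
    (hs : AEMeasurable s μ)
    (hmom : ∀ j : ℕ, Integrable (fun x => w x * s x ^ j) μ)
    (hsD : ∀ᵐ x ∂μ, ∀ z, |z| < a → s x * z ∈ D) (j : ℕ) :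
    iteratedDeriv j (fun z => ∫ x, w x * φ (s x * z) ∂μ) 0 =
      (∫ x, w x * s x ^ j ∂μ) * iteratedDeriv j φ 0 := by
  have hmeasd : ∀ j, Measurable (iteratedDeriv j φ) := by
    intro j
    induction j with
    | zero => simpa using hφ
    | succ j ih => rw [iteratedDeriv_succ]; exact measurable_deriv _
  have hderiv : ∀ j, ∀ v ∈ D, HasDerivAt (iteratedDeriv j φ) (iteratedDeriv (j + 1) φ v) v := by
    intro j v hv
    rw [iteratedDeriv_succ]
    have h1 : ContDiffAt ℝ ∞ φ v := hφD.contDiffAt (hD.mem_nhds hv)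
    have h2 := h1.contDiffWithinAt.differentiableWithinAt_iteratedDerivWithin (m := j) (s := Set.univ)
      (by exact_mod_cast WithTop.coe_lt_top j) (by simp [uniqueDiffOn_univ])
    rw [iteratedDerivWithin_univ, differentiableWithinAt_univ] at h2
    exact h2.hasDerivAt
  have key := hasDerivAt_integral_family (μ := μ) (a := a)
    (fun j z x => w x * s x ^ j * iteratedDeriv j φ (s x * z)) (fun j x => |w x * s x ^ j| * C j)
    (fun j z _ => (hmom j).aestronglyMeasurable.mul
      ((hmeasd j).comp_aemeasurable (hs.mul_const z)).aestronglyMeasurable)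
    (fun j => by
      filter_upwards [hsD] with x hx z hz
      rw [abs_mul]
      exact mul_le_mul_of_nonneg_left (hC j _ (hx z hz)) (abs_nonneg _))
    (fun j => (hmom j).abs.mul_const _)
    (fun j => by
      filter_upwards [hsD] with x hx z hz
      have h1 : HasDerivAt (fun z => s x * z) (s x) z := by
        simpa using (hasDerivAt_id z).const_mul (s x)
      have h2 := ((hderiv j _ (hx z hz)).comp z h1).const_mul (w x * s x ^ j)
      simpa only [Function.comp_def, pow_succ, mul_assoc, mul_comm (s x)] using h2)
  have h := iteratedDeriv_eq_of_hasDerivAt key j 0 (by simpa using ha)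
  simp only [pow_zero, mul_one, iteratedDeriv_zero, mul_zero] at h
  rw [h, ← integral_mul_const]

/-- The regularized integral of a superposition of dilates of `φ`. The hypothesis `hBd` makes the
Taylor polynomial of the superposition the superposition of the Taylor polynomials, and the dilation by
`s` multiplies the regularized integral by `s ^ k`. -/
theorem integral_taylorQuotient_superposition {X : Type*} [MeasurableSpace X] {μ : Measure X}
    [SFinite μ] {w s : X → ℝ} {φ B : ℝ → ℝ} {C : ℝ} {k : ℕ} (hφ : Measurable φ)
    (hC : ∀ z, |φ z| ≤ C) (hw : Measurable w) (hs : Measurable s)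
    (hs0 : ∀ᵐ x ∂μ, 0 < s x)
    (hmom : ∀ j : ℕ, Integrable (fun x => w x * s x ^ j) μ)
    (hB : ∀ z, B z = ∫ x, w x * φ (s x * z) ∂μ)
    (hBd : ∀ j, iteratedDeriv j B 0 = (∫ x, w x * s x ^ j ∂μ) * iteratedDeriv j φ 0)
    (hq : IntegrableOn (taylorQuotient φ k) (Set.Ioi 0)) :
    ∫ z in Set.Ioi 0, taylorQuotient B k z =
      (∫ x, w x * s x ^ k ∂μ) * ∫ z in Set.Ioi 0, taylorQuotient φ k z := by
  have hmq := measurable_taylorQuotient hφ k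
  have hw0 : Integrable w μ := by simpa using hmom 0
  have hpt : ∀ z ∈ Set.Ioi (0 : ℝ), taylorQuotient B k z =
      ∫ x, w x * s x ^ (k + 1) * taylorQuotient φ k (s x * z) ∂μ := by
    intro z hz
    have hz0 : z ≠ 0 := (Set.mem_Ioi.1 hz).ne'
    have hi0 : Integrable (fun x => w x * φ (s x * z)) μ :=
      hw0.mul_bdd (hφ.comp (hs.mul_const z)).aestronglyMeasurable
        (Filter.Eventually.of_forall fun x => hC _)
    have hij : ∀ j ∈ Finset.range ((k + 1) / 2), Integrable (fun x => w x *
        (iteratedDeriv (2 * j) φ 0 * (s x * z) ^ (2 * j) / ((2 * j).factorial : ℝ))) μ := by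
      intro j _
      convert (hmom (2 * j)).mul_const
        (iteratedDeriv (2 * j) φ 0 * z ^ (2 * j) / ((2 * j).factorial : ℝ)) using 2 with x
      rw [mul_pow]; ring
    have h1 : taylorQuotient B k z = (∫ x, (w x * φ (s x * z) - ∑ j ∈ Finset.range ((k + 1) / 2),
        w x * (iteratedDeriv (2 * j) φ 0 * (s x * z) ^ (2 * j) / ((2 * j).factorial : ℝ))) ∂μ) /
        z ^ (k + 1) := by
      rw [integral_sub hi0 (integrable_finsetSum _ hij), integral_finsetSum _ hij,
        taylorQuotient, hB]
      congr 2
      refine Finset.sum_congr rfl fun j _ => ?_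
      rw [hBd, ← integral_mul_const, ← integral_mul_const, ← integral_div]
      refine integral_congr_ae (Filter.Eventually.of_forall fun x => ?_)
      simp only [mul_pow]; ring
    rw [h1, ← integral_div]
    refine integral_congr_ae ?_
    filter_upwards [hs0] with x hx
    have hx0 := hx.ne'
    rw [taylorQuotient, mul_pow, ← Finset.mul_sum]
    field_simp
  rw [setIntegral_congr_fun measurableSet_Ioi hpt]
  have hscale : ∀ x, 0 < s x → ∀ q : ℝ → ℝ,
      ∫ z in Set.Ioi 0, q (s x * z) = (s x)⁻¹ * ∫ z in Set.Ioi 0, q z := by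
    intro x hx q
    have := integral_comp_mul_left_Ioi q 0 hx
    simpa using this
  rw [integral_integral_swap]
  · rw [← integral_mul_const]
    refine integral_congr_ae ?_
    filter_upwards [hs0] with x hx
    rw [integral_const_mul, hscale x hx, pow_succ]
    field_simp
  · have hmeas : Measurable (Function.uncurry fun (z : ℝ) (x : X) =>
        w x * s x ^ (k + 1) * taylorQuotient φ k (s x * z)) := by
      unfold Function.uncurry
      exact ((hw.comp measurable_snd).mul ((hs.comp measurable_snd).pow_const _)).mul
        (hmq.comp ((hs.comp measurable_snd).mul measurable_fst))
    rw [integrable_prod_iff' hmeas.aestronglyMeasurable]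
    constructor
    · filter_upwards [hs0] with x hx
      have := (integrableOn_Ioi_comp_mul_left_iff (taylorQuotient φ k) 0 hx).2 (by simpa using hq)
      exact this.const_mul (w x * s x ^ (k + 1))
    · have hI : Integrable (fun x => |w x * s x ^ k| *
          ∫ z in Set.Ioi 0, |taylorQuotient φ k z|) μ := (hmom k).abs.mul_const _
      refine hI.congr ?_
      filter_upwards [hs0] with x hx
      simp only [Function.uncurry, norm_mul, Real.norm_eq_abs, integral_const_mul]
      rw [hscale x hx fun v => |taylorQuotient φ k v|, abs_mul, abs_pow, abs_pow, abs_of_pos hx, pow_succ]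
      field_simp

/-! ### The regularized integral of the cosine -/

theorem integral_Ioi_pow_mul_exp_neg_mul (p : ℕ) {s : ℝ} (hs : 0 < s) :
    ∫ u in Set.Ioi 0, u ^ p * Real.exp (-(s * u)) = p.factorial / s ^ (p + 1) := by
  have h := Real.integral_rpow_mul_exp_neg_mul_Ioi (a := (p : ℝ) + 1) (by positivity) hs
  rw [Real.Gamma_nat_eq_factorial] at h
  have h2 : (1 / s) ^ ((p : ℝ) + 1) = 1 / s ^ (p + 1) := by
    rw [show (p : ℝ) + 1 = ((p + 1 : ℕ) : ℝ) by push_cast; ring, Real.rpow_natCast, one_div_pow]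
  rw [h2] at h
  calc _ = ∫ u in Set.Ioi 0, u ^ ((p : ℝ) + 1 - 1) * Real.exp (-(s * u)) := by
        refine setIntegral_congr_fun measurableSet_Ioi fun u _ => ?_
        simp only [add_sub_cancel_right, Real.rpow_natCast]
    _ = _ := by rw [h]; ring

theorem integrableOn_Ioi_pow_mul_exp_neg_mul (p : ℕ) {s : ℝ} (hs : 0 < s) :
    IntegrableOn (fun u => u ^ p * Real.exp (-(s * u))) (Set.Ioi 0) := by
  by_contra h
  have h1 := integral_Ioi_pow_mul_exp_neg_mul p hs
  rw [integral_undef h] at h1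
  have : (0 : ℝ) < p.factorial / s ^ (p + 1) := by positivity
  linarith

theorem integral_Ioi_cos_mul_exp_neg_mul {s : ℝ} (hs : 0 < s) :
    IntegrableOn (fun u => Real.cos u * Real.exp (-(s * u))) (Set.Ioi 0) ∧
    ∫ u in Set.Ioi 0, Real.cos u * Real.exp (-(s * u)) = s / (s ^ 2 + 1) := by
  have ha : (-(s : ℂ) + Complex.I).re < 0 := by simpa using hs
  have hi := integrableOn_exp_mul_complex_Ioi ha 0
  have h := integral_exp_mul_complex_Ioi ha 0
  have hre : ∀ u : ℝ, Real.cos u * Real.exp (-(s * u)) =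
      RCLike.re (Complex.exp ((-(s : ℂ) + Complex.I) * u)) := by
    intro u
    rw [RCLike.re_to_complex, Complex.exp_re]
    simp [mul_comm]
  simp only [hre]
  refine ⟨hi.re, ?_⟩
  rw [integral_re hi, h]
  simp [Complex.div_re, Complex.normSq_apply]
  field_simp

theorem iteratedDeriv_two_mul_cos_zero (j : ℕ) : iteratedDeriv (2 * j) Real.cos 0 = (-1) ^ j := by
  simp [Real.iteratedDeriv_even_cos]

/-- The Laplace transform of the Taylor remainder of the cosine is a geometric sum. -/
theorem integral_Ioi_cos_sub_taylor_mul_exp (m : ℕ) {s : ℝ} (hs : 0 < s) :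
    ∫ u in Set.Ioi 0, (Real.cos u - ∑ j ∈ Finset.range m,
      (-1) ^ j * u ^ (2 * j) / ((2 * j).factorial : ℝ)) * Real.exp (-(s * u)) =
      (-1) ^ m * s / (s ^ (2 * m) * (s ^ 2 + 1)) := by
  have hj : ∀ j ∈ Finset.range m, IntegrableOn (fun u : ℝ => (-1) ^ j / ((2 * j).factorial : ℝ) *
      (u ^ (2 * j) * Real.exp (-(s * u)))) (Set.Ioi 0) := fun j _ =>
    (integrableOn_Ioi_pow_mul_exp_neg_mul (2 * j) hs).const_mul _
  obtain ⟨hci, hc⟩ := integral_Ioi_cos_mul_exp_neg_mul hs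
  have h1 : ∀ u : ℝ, (Real.cos u - ∑ j ∈ Finset.range m,
      (-1) ^ j * u ^ (2 * j) / ((2 * j).factorial : ℝ)) * Real.exp (-(s * u)) =
      Real.cos u * Real.exp (-(s * u)) - ∑ j ∈ Finset.range m, (-1) ^ j / ((2 * j).factorial : ℝ) *
      (u ^ (2 * j) * Real.exp (-(s * u))) := by
    intro u
    rw [sub_mul, Finset.sum_mul]
    congr 1
    exact Finset.sum_congr rfl fun j _ => by ring
  simp only [h1]
  rw [integral_sub hci (integrable_finsetSum _ hj), integral_finsetSum _ hj, hc]
  have h2 : ∀ j, ∫ u in Set.Ioi 0, (-1) ^ j / ((2 * j).factorial : ℝ) *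
      (u ^ (2 * j) * Real.exp (-(s * u))) = (-1) ^ j / s ^ (2 * j + 1) := by
    intro j
    rw [integral_const_mul, integral_Ioi_pow_mul_exp_neg_mul _ hs]
    field_simp
  simp only [h2]
  clear hj h1 h2 hci hc
  induction m with
  | zero => simp
  | succ m ih =>
    rw [Finset.sum_range_succ, ← sub_sub, ih]
    field_simp
    ring

/-- With `u ^ (-k-1) = (k!)⁻¹ ∫₀^∞ s ^ k exp(-u s) ds` the regularized integral becomes that of
`s ^ k` times a Laplace transform, which is `± (k!)⁻¹ ∫₀^∞ ds / (1 + s ^ 2)`. -/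
theorem integral_taylorQuotient_cos {k : ℕ} (hk : Odd k) :
    IntegrableOn (taylorQuotient Real.cos k) (Set.Ioi 0) ∧
    ∫ u in Set.Ioi 0, taylorQuotient Real.cos k u =
      (-1) ^ ((k + 1) / 2) * Real.pi / (2 * k.factorial) := by
  have hint : IntegrableOn (taylorQuotient Real.cos k) (Set.Ioi 0) :=
    integrableOn_taylorQuotient Real.measurable_cos Real.abs_cos_le_one Real.cos_neg
      Real.contDiff_cos.contDiffAt hk
  refine ⟨hint, ?_⟩
  set R : ℝ → ℝ := fun u => Real.cos u - ∑ j ∈ Finset.range ((k + 1) / 2),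
      (-1) ^ j * u ^ (2 * j) / ((2 * j).factorial : ℝ) with hR
  have hq : ∀ u, taylorQuotient Real.cos k u = R u / u ^ (k + 1) := by
    intro u
    simp only [taylorQuotient, iteratedDeriv_two_mul_cos_zero, hR]
  have hmR : Measurable R := by rw [hR]; fun_prop
  have hrep : ∀ u ∈ Set.Ioi (0 : ℝ), taylorQuotient Real.cos k u =
      (k.factorial : ℝ)⁻¹ * ∫ s in Set.Ioi 0, R u * (s ^ k * Real.exp (-(u * s))) := by
    intro u hu
    rw [hq, integral_const_mul, integral_Ioi_pow_mul_exp_neg_mul k hu]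
    field_simp
  rw [setIntegral_congr_fun measurableSet_Ioi hrep, integral_const_mul, integral_integral_swap]
  · have h1 : ∀ s ∈ Set.Ioi (0 : ℝ), ∫ u in Set.Ioi 0, R u * (s ^ k * Real.exp (-(u * s))) =
        (-1) ^ ((k + 1) / 2) * (1 + s ^ 2)⁻¹ := by
      intro s hs
      have hs0 : (0 : ℝ) < s := hs
      have h2 := integral_Ioi_cos_sub_taylor_mul_exp ((k + 1) / 2) hs0
      have h3 : 2 * ((k + 1) / 2) = k + 1 := by obtain ⟨m, rfl⟩ := hk; omega
      rw [h3] at h2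
      calc _ = s ^ k * ∫ u in Set.Ioi 0, R u * Real.exp (-(s * u)) := by
            rw [← integral_const_mul]
            refine integral_congr_ae (Filter.Eventually.of_forall fun u => ?_)
            simp only [mul_comm u s]; ring
        _ = _ := by
            rw [h2]; field_simp; ring
    rw [setIntegral_congr_fun measurableSet_Ioi h1, integral_const_mul, integral_Ioi_inv_one_add_sq,
      Real.arctan_zero]
    field_simp
    ring
  · have hmeas : Measurable (Function.uncurry fun (u s : ℝ) =>
        R u * (s ^ k * Real.exp (-(u * s)))) := by
      unfold Function.uncurry
      exact (hmR.comp measurable_fst).mul (by fun_prop)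
    rw [integrable_prod_iff hmeas.aestronglyMeasurable]
    constructor
    · refine (ae_restrict_iff' measurableSet_Ioi).2 (Filter.Eventually.of_forall fun u hu => ?_)
      exact (integrableOn_Ioi_pow_mul_exp_neg_mul k hu).const_mul (R u)
    · refine IntegrableOn.congr_fun (hint.norm.const_mul (k.factorial : ℝ)) (fun u hu => ?_)
        measurableSet_Ioi
      have hu0 : (0 : ℝ) < u := hu
      have h4 : ∫ s in Set.Ioi 0, ‖R u * (s ^ k * Real.exp (-(u * s)))‖ =
          |R u| * ∫ s in Set.Ioi 0, s ^ k * Real.exp (-(u * s)) := by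
        rw [← integral_const_mul]
        refine setIntegral_congr_fun measurableSet_Ioi fun s hs => ?_
        have hs0 : (0 : ℝ) < s := hs
        simp only [norm_mul, Real.norm_eq_abs, Real.abs_exp, abs_pow, abs_of_pos hs0]
      simp only [Function.uncurry]
      rw [h4, integral_Ioi_pow_mul_exp_neg_mul k hu0, hq, Real.norm_eq_abs, abs_div, abs_pow,
        abs_of_pos hu0]
      ring

/-! ### The radial function of a star body -/

section Radial

variable {n : ℕ} {K : Set (EuclideanSpace ℝ (Fin n))}

theorem radialFunction_zero (K : Set (EuclideanSpace ℝ (Fin n))) : radialFunction K 0 = 0 := by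
  unfold radialFunction
  by_cases h : (0 : EuclideanSpace ℝ (Fin n)) ∈ K
  · have : {a : ℝ | 0 < a ∧ a • (0 : EuclideanSpace ℝ (Fin n)) ∈ K} = Set.Ioi 0 := by
      ext a; simp [h]
    rw [this, Real.sSup_of_not_bddAbove (not_bddAbove_Ioi 0)]
  · have : {a : ℝ | 0 < a ∧ a • (0 : EuclideanSpace ℝ (Fin n)) ∈ K} = ∅ := by
      ext a; simp [h]
    rw [this, Real.sSup_empty]

theorem radialFunction_smul (K : Set (EuclideanSpace ℝ (Fin n))) {c : ℝ} (hc : 0 < c)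
    (x : EuclideanSpace ℝ (Fin n)) : radialFunction K (c • x) = c⁻¹ * radialFunction K x := by
  unfold radialFunction
  rw [← smul_eq_mul, ← Real.sSup_smul_of_nonneg (inv_nonneg.2 hc.le)]
  congr 1
  ext a
  rw [Set.mem_smul_set_iff_inv_smul_mem₀ (inv_ne_zero hc.ne'), inv_inv]
  simp only [Set.mem_ofPred_eq, smul_smul, smul_eq_mul, mul_comm c a]
  rw [mul_pos_iff_of_pos_right hc]

theorem radialFunction_neg (hsymm : ∀ x ∈ K, -x ∈ K) (x : EuclideanSpace ℝ (Fin n)) :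
    radialFunction K (-x) = radialFunction K x := by
  unfold radialFunction
  congr 1
  ext a
  simp only [Set.mem_ofPred_eq, smul_neg]
  exact and_congr_right fun _ => ⟨fun h => by simpa using hsymm _ h, fun h => hsymm _ h⟩

theorem radialFunction_eq_inv_norm_mul (x : EuclideanSpace ℝ (Fin n)) (hx : x ≠ 0) :
    radialFunction K x = ‖x‖⁻¹ * radialFunction K (‖x‖⁻¹ • x) := by
  have hx0 := norm_pos_iff.2 hx
  rw [← radialFunction_smul K hx0, smul_smul, mul_inv_cancel₀ hx0.ne', one_smul]

theorem inv_norm_smul_mem_sphere {x : EuclideanSpace ℝ (Fin n)} (hx : x ≠ 0) :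
    ‖x‖⁻¹ • x ∈ Metric.sphere (0 : EuclideanSpace ℝ (Fin n)) 1 := by
  simp [norm_smul, hx]

namespace IsStarBody

theorem radialFunction_pos (hK : IsStarBody K) {x : EuclideanSpace ℝ (Fin n)} (hx : x ≠ 0) :
    0 < radialFunction K x := by
  rw [radialFunction_eq_inv_norm_mul x hx]
  exact mul_pos (inv_pos.2 (norm_pos_iff.2 hx)) (hK.radial_pos _ (inv_norm_smul_mem_sphere hx))

theorem radialFunction_nonneg (hK : IsStarBody K) (x : EuclideanSpace ℝ (Fin n)) :
    0 ≤ radialFunction K x := by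
  rcases eq_or_ne x 0 with rfl | hx
  · rw [radialFunction_zero]
  · exact (hK.radialFunction_pos hx).le

theorem smul_mem (hK : IsStarBody K) {x : EuclideanSpace ℝ (Fin n)} (hx : x ∈ K) {a : ℝ}
    (ha0 : 0 ≤ a) (ha1 : a ≤ 1) : a • x ∈ K :=
  hK.starConvex.smul_mem hx ha0 ha1

theorem exists_norm_le (hK : IsStarBody K) : ∃ R > 0, ∀ x ∈ K, ‖x‖ ≤ R := by
  obtain ⟨R, hR, h⟩ := hK.isCompact.isBounded.exists_pos_norm_le
  exact ⟨R, hR, h⟩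

theorem smul_mem_iff (hK : IsStarBody K) {x : EuclideanSpace ℝ (Fin n)} (hx : x ≠ 0) {a : ℝ}
    (ha : 0 < a) : a • x ∈ K ↔ a ≤ radialFunction K x := by
  set S := {a : ℝ | 0 < a ∧ a • x ∈ K} with hS
  have hpos : 0 < sSup S := hK.radialFunction_pos hx
  have hne : S.Nonempty := by
    by_contra h
    rw [Set.not_nonempty_iff_eq_empty.1 h, Real.sSup_empty] at hpos
    exact lt_irrefl _ hpos
  have hbdd : BddAbove S := by
    obtain ⟨R, -, hR⟩ := hK.exists_norm_le
    refine ⟨R / ‖x‖, fun b hb => ?_⟩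
    rw [le_div_iff₀ (norm_pos_iff.2 hx)]
    simpa [norm_smul, abs_of_pos hb.1] using hR _ hb.2
  constructor
  · exact fun h => le_csSup hbdd ⟨ha, h⟩
  · intro h
    have hclosed : IsClosed {b : ℝ | b • x ∈ K} :=
      hK.isCompact.isClosed.preimage (continuous_id.smul continuous_const)
    have hmem : sSup S • x ∈ K :=
      hclosed.closure_subset_iff.2 (fun b hb => hb.2) (csSup_mem_closure hne hbdd)
    have h1 := hK.smul_mem hmem (a := a / sSup S) (by positivity) ((div_le_one hpos).2 h)
    rwa [smul_smul, div_mul_cancel₀ _ hpos.ne'] at h1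

theorem mem_iff (hK : IsStarBody K) {x : EuclideanSpace ℝ (Fin n)} (hx : x ≠ 0) :
    x ∈ K ↔ 1 ≤ radialFunction K x := by
  simpa using hK.smul_mem_iff hx one_pos

theorem zero_mem (hK : IsStarBody K) [NeZero n] : (0 : EuclideanSpace ℝ (Fin n)) ∈ K := by
  have : Nontrivial (EuclideanSpace ℝ (Fin n)) :=
    ⟨⟨EuclideanSpace.single 0 1, 0, by simp⟩⟩
  obtain ⟨x, hx⟩ := exists_ne (0 : EuclideanSpace ℝ (Fin n))
  have h := (hK.smul_mem_iff hx (hK.radialFunction_pos hx)).2 le_rfl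
  simpa using hK.smul_mem h le_rfl zero_le_one

theorem radialFunction_bounds (hK : IsStarBody K) : ∃ m > 0, ∃ M > 0,
    ∀ x : EuclideanSpace ℝ (Fin n), x ≠ 0 →
      m * ‖x‖⁻¹ ≤ radialFunction K x ∧ radialFunction K x ≤ M * ‖x‖⁻¹ := by
  have hcpt : IsCompact (Metric.sphere (0 : EuclideanSpace ℝ (Fin n)) 1) := isCompact_sphere _ _
  rcases (Metric.sphere (0 : EuclideanSpace ℝ (Fin n)) 1).eq_empty_or_nonempty with he | hne
  · refine ⟨1, one_pos, 1, one_pos, fun x hx => ?_⟩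
    have := inv_norm_smul_mem_sphere hx
    rw [he] at this
    exact this.elim
  obtain ⟨x₁, hx₁, h₁⟩ := hcpt.exists_isMinOn hne hK.radial_continuousOn
  obtain ⟨x₂, hx₂, h₂⟩ := hcpt.exists_isMaxOn hne hK.radial_continuousOn
  refine ⟨_, hK.radial_pos x₁ hx₁, _, hK.radial_pos x₂ hx₂, fun x hx => ?_⟩
  have hx0 := inv_nonneg.2 (norm_nonneg x)
  rw [radialFunction_eq_inv_norm_mul x hx, mul_comm]
  constructor
  · exact mul_le_mul_of_nonneg_left (h₁ (inv_norm_smul_mem_sphere hx)) hx0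
  · rw [mul_comm]
    exact mul_le_mul_of_nonneg_right (h₂ (inv_norm_smul_mem_sphere hx)) hx0

end IsStarBody

theorem HasSmoothBoundary.contDiffOn (h : HasSmoothBoundary K) :
    ContDiffOn ℝ ∞ (radialFunction K) {0}ᶜ := h

theorem HasSmoothBoundary.contDiffAt (h : HasSmoothBoundary K) {x : EuclideanSpace ℝ (Fin n)}
    (hx : x ≠ 0) : ContDiffAt ℝ ∞ (radialFunction K) x :=
  h.contDiffOn.contDiffAt (isOpen_compl_singleton.mem_nhds hx)

theorem HasSmoothBoundary.measurable (h : HasSmoothBoundary K) :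
    Measurable (radialFunction K) :=
  measurable_of_continuousOn_compl_singleton 0 h.contDiffOn.continuousOn

end Radial

/-! ### Integrals of smooth functions along a family of inverse functions -/

section InverseFamily

variable {V : Type*} [NormedAddCommGroup V] [NormedSpace ℝ V]

/-- The partial derivative of a function on `V × ℝ` in the real variable. -/
noncomputable def partialSnd (G : V × ℝ → ℝ) (p : V × ℝ) : ℝ := fderiv ℝ G p (0, 1)

theorem contDiffOn_partialSnd {G : V × ℝ → ℝ} {U : Set (V × ℝ)} (hU : IsOpen U)
    (hG : ContDiffOn ℝ ∞ G U) : ContDiffOn ℝ ∞ (partialSnd G) U :=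
  (hG.fderiv_of_isOpen hU (m := ∞) (by simp)).clm_apply contDiffOn_const

theorem hasDerivAt_partialSnd {G : V × ℝ → ℝ} {U : Set (V × ℝ)} (hU : IsOpen U)
    (hG : ContDiffOn ℝ ∞ G U) {y : V} {w : ℝ} (h : (y, w) ∈ U) :
    HasDerivAt (fun w => G (y, w)) (partialSnd G (y, w)) w := by
  have h1 : HasFDerivAt G (fderiv ℝ G (y, w)) (y, w) :=
    ((hG.contDiffAt (hU.mem_nhds h)).differentiableAt (by simp)).hasFDerivAt
  have h2 : HasDerivAt (fun w : ℝ => (y, w)) ((0 : V), (1 : ℝ)) w :=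
    (hasDerivAt_const w y).prodMk (hasDerivAt_id w)
  exact h1.comp_hasDerivAt w h2

theorem strictMonoOn_of_partialSnd_pos {Z : V × ℝ → ℝ} {U : Set (V × ℝ)} (hU : IsOpen U)
    (hZ : ContDiffOn ℝ ∞ Z U) {δ : ℝ} {y : V}
    (hpos : ∀ w, |w| ≤ δ → (y, w) ∈ U ∧ 0 < partialSnd Z (y, w)) :
    StrictMonoOn (fun w => Z (y, w)) (Set.Icc (-δ) δ) := by
  refine strictMonoOn_of_deriv_pos (convex_Icc _ _) (fun w hw => ?_) fun w hw => ?_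
  · exact (hasDerivAt_partialSnd hU hZ
      (hpos w (abs_le.2 hw)).1).continuousAt.continuousWithinAt
  · rw [interior_Icc] at hw
    have h := hpos w (abs_le.2 ⟨hw.1.le, hw.2.le⟩)
    rw [(hasDerivAt_partialSnd hU hZ h.1).deriv]
    exact h.2

/-- Let `Z(θ, w)` be smooth and strictly increasing in `w ∈ [-δ, δ]` for each `θ` in the unit
sphere, and let `W(θ, z)` be the inverse of `Z(θ, ·)`. Differentiation of `G(θ, W(θ, z))` in `z`
amounts to replacing `G` by `∂_w G / ∂_w Z`, so integrals of such functions over `θ` are smooth. -/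
theorem exists_inverse_contDiffOn_integral [FiniteDimensional ℝ V] [MeasurableSpace V]
    [BorelSpace V] (σ : Measure (Metric.sphere (0 : V) 1)) [IsFiniteMeasure σ]
    {Z : V × ℝ → ℝ} {U : Set (V × ℝ)} (hU : IsOpen U) (hZ : ContDiffOn ℝ ∞ Z U) {δ z₀ : ℝ}
    (hδ : 0 < δ)
    (hpos : ∀ y ∈ Metric.sphere (0 : V) 1, ∀ w, |w| ≤ δ → (y, w) ∈ U ∧ 0 < partialSnd Z (y, w))
    (hz₀ : ∀ y ∈ Metric.sphere (0 : V) 1, Z (y, -δ) ≤ -z₀ ∧ z₀ ≤ Z (y, δ)) :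
    ∃ W : Metric.sphere (0 : V) 1 → ℝ → ℝ,
      (∀ θ z, |z| < z₀ → |W θ z| < δ ∧ Z (θ, W θ z) = z) ∧
      (∀ z, |z| < z₀ → Continuous fun θ => W θ z) ∧
      ∀ G : V × ℝ → ℝ, ContDiffOn ℝ ∞ G U →
        ContDiffOn ℝ ∞ (fun z => ∫ θ, G ((θ : V), W θ z) ∂σ) {z | |z| < z₀} := by
  have hcont : ∀ θ : Metric.sphere (0 : V) 1, ContinuousOn (fun w => Z (θ, w)) (Set.Icc (-δ) δ) :=
    fun θ w hw => (hasDerivAt_partialSnd hU hZ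
      (hpos θ θ.2 w (abs_le.2 hw)).1).continuousAt.continuousWithinAt
  have hmono : ∀ θ : Metric.sphere (0 : V) 1,
      StrictMonoOn (fun w => Z (θ, w)) (Set.Icc (-δ) δ) :=
    fun θ => strictMonoOn_of_partialSnd_pos hU hZ (hpos θ θ.2)
  have hex : ∀ (θ : Metric.sphere (0 : V) 1) (z : ℝ), |z| < z₀ →
      ∃ w, |w| < δ ∧ Z (θ, w) = z := by
    intro θ z hz
    have h := hz₀ θ θ.2
    have h1 := abs_lt.1 hz
    obtain ⟨w, hw, hwz⟩ := intermediate_value_Ioo (by linarith) (hcont θ)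
      (show z ∈ Set.Ioo (Z (θ, -δ)) (Z (θ, δ)) from ⟨by linarith, by linarith⟩)
    exact ⟨w, abs_lt.2 hw, hwz⟩
  choose! W hW using hex
  have hmem : ∀ {w : ℝ}, |w| < δ → w ∈ Set.Icc (-δ) δ := fun h => abs_le.1 h.le
  have hlt : ∀ θ z, |z| < z₀ → ∀ a, |a| < δ → (a < W θ z ↔ Z (θ, a) < z) := by
    intro θ z hz a ha
    rw [← (hmono θ).lt_iff_lt (hmem ha) (hmem (hW θ z hz).1)]
    simp only [(hW θ z hz).2]
  have hgt : ∀ θ z, |z| < z₀ → ∀ a, |a| < δ → (W θ z < a ↔ z < Z (θ, a)) := by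
    intro θ z hz a ha
    rw [← (hmono θ).lt_iff_lt (hmem (hW θ z hz).1) (hmem ha)]
    simp only [(hW θ z hz).2]
  have hopen : IsOpen {z : ℝ | |z| < z₀} := isOpen_lt continuous_abs continuous_const
  have hZθ : ∀ w, |w| ≤ δ → Continuous fun θ : Metric.sphere (0 : V) 1 => Z (θ, w) := by
    intro w hw
    exact hZ.continuousOn.comp_continuous (by fun_prop) fun θ => (hpos θ θ.2 w hw).1
  have hWθ : ∀ z, |z| < z₀ → Continuous fun θ => W θ z := by
    intro z hz
    refine continuous_iff_continuousAt.2 fun θ => tendsto_order.2 ⟨fun a ha => ?_, fun a ha => ?_⟩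
    · obtain ⟨b, hb1, hb2⟩ := exists_between (max_lt ha (abs_lt.1 (hW θ z hz).1).1)
      have hbδ : |b| < δ := abs_lt.2
        ⟨(le_max_right _ _).trans_lt hb1, hb2.trans (abs_lt.1 (hW θ z hz).1).2⟩
      have h1 := (hlt θ z hz b hbδ).1 hb2
      filter_upwards [(hZθ b hbδ.le).continuousAt.eventually_lt_const h1] with θ' h2
      exact ((le_max_left _ _).trans_lt hb1).trans ((hlt θ' z hz b hbδ).2 h2)
    · obtain ⟨b, hb1, hb2⟩ := exists_between (lt_min ha (abs_lt.1 (hW θ z hz).1).2)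
      have hbδ : |b| < δ := abs_lt.2
        ⟨(abs_lt.1 (hW θ z hz).1).1.trans hb1, hb2.trans_le (min_le_right _ _)⟩
      have h1 := (hgt θ z hz b hbδ).1 hb1
      filter_upwards [(hZθ b hbδ.le).continuousAt.eventually_const_lt h1] with θ' h2
      exact ((hgt θ' z hz b hbδ).2 h2).trans (hb2.trans_le (min_le_left _ _))
  have hWz : ∀ θ z, |z| < z₀ → ContinuousAt (W θ) z := by
    intro θ z hz
    refine tendsto_order.2 ⟨fun a ha => ?_, fun a ha => ?_⟩
    · obtain ⟨b, hb1, hb2⟩ := exists_between (max_lt ha (abs_lt.1 (hW θ z hz).1).1)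
      have hbδ : |b| < δ := abs_lt.2
        ⟨(le_max_right _ _).trans_lt hb1, hb2.trans (abs_lt.1 (hW θ z hz).1).2⟩
      have h1 := (hlt θ z hz b hbδ).1 hb2
      filter_upwards [eventually_gt_nhds h1, hopen.mem_nhds hz] with z' h2 h3
      exact ((le_max_left _ _).trans_lt hb1).trans ((hlt θ z' h3 b hbδ).2 h2)
    · obtain ⟨b, hb1, hb2⟩ := exists_between (lt_min ha (abs_lt.1 (hW θ z hz).1).2)
      have hbδ : |b| < δ := abs_lt.2
        ⟨(abs_lt.1 (hW θ z hz).1).1.trans hb1, hb2.trans_le (min_le_right _ _)⟩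
      have h1 := (hgt θ z hz b hbδ).1 hb1
      filter_upwards [eventually_lt_nhds h1, hopen.mem_nhds hz] with z' h2 h3
      exact ((hgt θ z' h3 b hbδ).2 h2).trans (hb2.trans_le (min_le_left _ _))
  have hWd : ∀ θ z, |z| < z₀ →
      HasDerivAt (W θ) (partialSnd Z (θ, W θ z))⁻¹ z := by
    intro θ z hz
    have h := hpos θ θ.2 _ (hW θ z hz).1.le
    refine HasDerivAt.of_local_left_inverse (hWz θ z hz) (hasDerivAt_partialSnd hU hZ h.1)
      h.2.ne' ?_
    filter_upwards [hopen.mem_nhds hz] with z' hz' using (hW θ z' hz').2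
  refine ⟨W, hW, hWθ, fun G hG => ?_⟩
  -- the open set on which the quotients `∂_w G / ∂_w Z` are smooth
  set U' : Set (V × ℝ) := U ∩ partialSnd Z ⁻¹' {0}ᶜ with hU'
  have hU'o : IsOpen U' :=
    (contDiffOn_partialSnd hU hZ).continuousOn.isOpen_inter_preimage hU isOpen_compl_singleton
  have hmemU' : ∀ y ∈ Metric.sphere (0 : V) 1, ∀ w, |w| ≤ δ → (y, w) ∈ U' := fun y hy w hw =>
    ⟨(hpos y hy w hw).1, (hpos y hy w hw).2.ne'⟩
  let Φ : ℕ → V × ℝ → ℝ := fun j => Nat.rec G (fun _ g p => partialSnd g p / partialSnd Z p) j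
  have hΦ : ∀ j, ContDiffOn ℝ ∞ (Φ j) U' := by
    intro j
    induction j with
    | zero => exact hG.mono Set.inter_subset_left
    | succ j ih =>
      exact (contDiffOn_partialSnd hU'o ih).div
        ((contDiffOn_partialSnd hU hZ).mono Set.inter_subset_left) fun p hp => hp.2
  have hcpt : IsCompact (Metric.sphere (0 : V) 1 ×ˢ Set.Icc (-δ) δ) :=
    (isCompact_sphere _ _).prod isCompact_Icc
  have hbd : ∀ j, ∃ C, ∀ p ∈ Metric.sphere (0 : V) 1 ×ˢ Set.Icc (-δ) δ, ‖Φ j p‖ ≤ C := fun j =>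
    hcpt.exists_bound_of_continuousOn ((hΦ j).continuousOn.mono fun p hp =>
      hmemU' p.1 hp.1 p.2 (abs_le.2 hp.2))
  choose C hC using hbd
  refine contDiffOn_of_hasDerivAt (I := fun j z => ∫ θ, Φ j ((θ : V), W θ z) ∂σ)
    (hasDerivAt_integral_family
      (fun j z (θ : Metric.sphere (0 : V) 1) => Φ j ((θ : V), W θ z)) (fun j _ => C j) ?_ ?_ ?_ ?_)
  · intro j z hz
    refine Continuous.aestronglyMeasurable ?_
    exact (hΦ j).continuousOn.comp_continuous (continuous_subtype_val.prodMk (hWθ z hz))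
      fun θ => hmemU' θ θ.2 _ (hW θ z hz).1.le
  · exact fun j => Filter.Eventually.of_forall fun θ z hz =>
      hC j _ ⟨θ.2, hmem (hW θ z hz).1⟩
  · exact fun j => integrable_const _
  · intro j
    refine Filter.Eventually.of_forall fun θ z hz => ?_
    have h1 := hasDerivAt_partialSnd hU'o (hΦ j) (hmemU' θ θ.2 _ (hW θ z hz).1.le)
    simpa [Φ, div_eq_mul_inv, Function.comp_def] using h1.comp z (hWd θ z hz)

end InverseFamily

/-! ### Smoothness of the parallel section function near zero -/

theorem volumeIoiPow_apply_Iic (n : ℕ) (x : Set.Ioi (0 : ℝ)) :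
    Measure.volumeIoiPow n (Set.Iic x) = ENNReal.ofReal (x.1 ^ (n + 1) / (n + 1)) := by
  have hr₀ : 0 ≤ x.1 := le_of_lt x.2
  rw [Measure.volumeIoiPow, withDensity_apply _ measurableSet_Iic,
    setLIntegral_subtype measurableSet_Ioi _ fun a : ℝ ↦ .ofReal (a ^ n),
    Set.image_subtype_val_Ioi_Iic,
    ← ofReal_integral_eq_lintegral_ofReal (intervalIntegral.intervalIntegrable_pow _).1,
    ← intervalIntegral.integral_of_le hr₀]
  · simp
  · filter_upwards [ae_restrict_mem measurableSet_Ioc] with y hy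
    exact pow_nonneg hy.1.le _

/-- The volume of a set that is, up to the origin, star-shaped with radial function `R`. -/
theorem measureReal_eq_integral_toSphere {V : Type*} [NormedAddCommGroup V] [NormedSpace ℝ V]
    [FiniteDimensional ℝ V] [Nontrivial V] [MeasurableSpace V] [BorelSpace V] (μ : Measure V)
    [μ.IsAddHaarMeasure] {s : Set V} {R : Metric.sphere (0 : V) 1 → ℝ} (hR : Measurable R)
    (hR0 : ∀ θ, 0 < R θ)
    (hs : ∀ (θ : Metric.sphere (0 : V) 1) (r : ℝ), 0 < r → (r • (θ : V) ∈ s ↔ r ≤ R θ)) :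
    μ.real s = ∫ θ, R θ ^ Module.finrank ℝ V / Module.finrank ℝ V ∂μ.toSphere := by
  have hd : 0 < Module.finrank ℝ V := Module.finrank_pos
  set T : Set (Metric.sphere (0 : V) 1 × Set.Ioi (0 : ℝ)) := {p | (p.2 : ℝ) ≤ R p.1} with hT
  have hTm : MeasurableSet T :=
    measurableSet_le (measurable_subtype_coe.comp measurable_snd) (hR.comp measurable_fst)
  have h1 : μ s = μ ((↑) '' (((↑) : ({0}ᶜ : Set V) → V) ⁻¹' s)) := by
    rw [Subtype.image_preimage_coe, Set.inter_comm, ← Set.sdiff_eq, measure_sdiff_null (by simp)]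
  have h2 : (((↑) : ({0}ᶜ : Set V) → V) ⁻¹' s) = homeomorphUnitSphereProd V ⁻¹' T := by
    ext x
    have hx : (x : V) ≠ 0 := x.2
    have hx0 := norm_pos_iff.2 hx
    have := hs (homeomorphUnitSphereProd V x).1 ‖(x : V)‖ hx0
    rw [homeomorphUnitSphereProd_apply_fst_coe, smul_smul, mul_inv_cancel₀ hx0.ne',
      one_smul] at this
    rw [Set.mem_preimage, this]
    simp [hT]
  have h3 : μ s = ∫⁻ θ, ENNReal.ofReal (R θ ^ Module.finrank ℝ V / Module.finrank ℝ V)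
      ∂μ.toSphere := by
    rw [h1, ← comap_subtype_coe_apply (measurableSet_singleton (0 : V)).compl, h2,
      (Measure.measurePreserving_homeomorphUnitSphereProd μ).measure_preimage
        hTm.nullMeasurableSet, Measure.prod_apply hTm]
    refine lintegral_congr fun θ => ?_
    have : Prod.mk θ ⁻¹' T = Set.Iic ⟨R θ, hR0 θ⟩ := by
      ext r; simp [hT, ← Subtype.coe_le_coe]
    rw [this, volumeIoiPow_apply_Iic, Nat.sub_add_cancel hd]
    congr 2
    rw [Nat.cast_sub hd]; simp
  rw [integral_eq_lintegral_of_nonneg_ae, measureReal_def, h3]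
  · exact Filter.Eventually.of_forall fun θ => by have := hR0 θ; positivity
  · exact ((hR.pow_const _).div_const _).aestronglyMeasurable

section Sections

variable {n : ℕ} {K : Set (EuclideanSpace ℝ (Fin n))} {ξ : EuclideanSpace ℝ (Fin n)}

theorem finrank_orthogonal_add_one (hξ : ‖ξ‖ = 1) :
    Module.finrank ℝ (ℝ ∙ ξ)ᗮ + 1 = n := by
  have h := Submodule.finrank_add_finrank_orthogonal (ℝ ∙ ξ)
  rw [finrank_span_singleton (by rintro rfl; simp at hξ), finrank_euclideanSpace_fin] at h
  omega

theorem norm_sq_add_smul (hξ : ‖ξ‖ = 1) (y : (ℝ ∙ ξ)ᗮ) (w : ℝ) :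
    ‖(y : EuclideanSpace ℝ (Fin n)) + w • ξ‖ ^ 2 = ‖y‖ ^ 2 + w ^ 2 := by
  have h : ⟪(y : EuclideanSpace ℝ (Fin n)), w • ξ⟫_ℝ = 0 := by
    rw [inner_smul_right, real_inner_comm,
      Submodule.mem_orthogonal_singleton_iff_inner_right.1 y.2, mul_zero]
  rw [sq, norm_add_sq_eq_norm_sq_add_norm_sq_of_inner_eq_zero _ _ h, norm_smul, hξ]
  simp [sq]

theorem measurableSet_section (hK : IsCompact K) (z : ℝ) :
    MeasurableSet {y : (ℝ ∙ ξ)ᗮ | (y : EuclideanSpace ℝ (Fin n)) + z • ξ ∈ K} :=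
  (hK.isClosed.preimage (by fun_prop :
    Continuous fun y : (ℝ ∙ ξ)ᗮ => (y : EuclideanSpace ℝ (Fin n)) + z • ξ)).measurableSet

/-- If `w` solves `w ρ_K(θ + w ξ) = z` with `z` small, then `r θ + z ξ` lies in `K` exactly for
`r ≤ ρ_K(θ + w ξ)`. -/
theorem IsStarBody.smul_add_smul_mem_iff (hK : IsStarBody K) {θ : EuclideanSpace ℝ (Fin n)}
    {δ m z w r : ℝ} (hδ : 0 < δ)
    (hlow : ∀ x : EuclideanSpace ℝ (Fin n), x ≠ 0 → m * ‖x‖⁻¹ ≤ radialFunction K x)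
    (hne : ∀ w : ℝ, θ + w • ξ ≠ 0) (hnorm : ∀ w : ℝ, ‖θ + w • ξ‖ ≤ 1 + |w|)
    (hmono : StrictMonoOn (fun w => w * radialFunction K (θ + w • ξ)) (Set.Icc (-δ) δ))
    (hz : |z| < m * δ / (1 + δ)) (hw : |w| < δ) (hwz : w * radialFunction K (θ + w • ξ) = z)
    (hr : 0 < r) : r • θ + z • ξ ∈ K ↔ r ≤ radialFunction K (θ + w • ξ) := by
  have hRpos : 0 < radialFunction K (θ + w • ξ) := hK.radialFunction_pos (hne w)
  have hx : r • θ + z • ξ = r • (θ + (z / r) • ξ) := by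
    rw [smul_add, smul_smul, mul_div_cancel₀ z hr.ne']
  rw [hx, hK.smul_mem_iff (hne _) hr]
  rcases lt_or_ge |z / r| δ with hsl | hsl
  · -- both sides compare `z / r` with the solution `w` by monotonicity
    have hle : ∀ w₁ w₂, |w₁| ≤ δ → |w₂| ≤ δ → (w₁ * radialFunction K (θ + w₁ • ξ) ≤
        w₂ * radialFunction K (θ + w₂ • ξ) ↔ w₁ ≤ w₂) := fun w₁ w₂ h₁ h₂ =>
      hmono.le_iff_le (abs_le.1 h₁) (abs_le.1 h₂)
    have hWeq : w = z / radialFunction K (θ + w • ξ) := by rw [eq_div_iff hRpos.ne', hwz]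
    have h1 := hle (z / r) w hsl.le hw.le
    have h2 := hle w (z / r) hw.le hsl.le
    rw [hwz] at h1 h2
    rcases eq_or_ne z 0 with rfl | hz0
    · have : w = 0 / r := by rw [hWeq]; simp
      rw [← this]
    generalize radialFunction K (θ + w • ξ) = R at *
    subst hWeq
    rw [div_mul_eq_mul_div] at h1 h2
    rcases lt_or_gt_of_ne hz0 with hz0 | hz0
    · rw [div_le_iff₀ hr, mul_le_mul_left_of_neg hz0, div_le_div_iff₀ hr hRpos,
        mul_le_mul_left_of_neg hz0] at h1
      exact h1
    · rw [le_div_iff₀ hr, mul_le_mul_iff_right₀ hz0, div_le_div_iff₀ hRpos hr,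
        mul_le_mul_iff_right₀ hz0] at h2
      exact h2
  · -- steep directions stay inside `K` since `z` is small
    have h1 : δ * r ≤ |z| := by
      rwa [abs_div, abs_of_pos hr, le_div_iff₀ hr] at hsl
    have h2 : |z| < δ * radialFunction K (θ + w • ξ) := by
      rw [← hwz, abs_mul, abs_of_pos hRpos]
      exact mul_lt_mul_of_pos_right hw hRpos
    refine iff_of_true ?_ (le_of_mul_le_mul_left (h1.trans h2.le) hδ)
    refine le_trans ?_ (hlow _ (hne _))
    have h4 := hnorm (z / r)
    have h5 := norm_pos_iff.2 (hne (z / r))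
    rw [← div_eq_mul_inv, le_div_iff₀ h5]
    calc r * ‖θ + (z / r) • ξ‖ ≤ r * (1 + |z / r|) := by gcongr
      _ = r + |z| := by rw [abs_div, abs_of_pos hr]; field_simp
      _ ≤ |z| / δ + |z| := by gcongr; rwa [le_div_iff₀ hδ, mul_comm]
      _ = |z| * ((1 + δ) / δ) := by field_simp
      _ ≤ m * δ / (1 + δ) * ((1 + δ) / δ) := by gcongr
      _ = m := by field_simp

theorem add_smul_ne_zero_of_mem_sphere (hξ : ‖ξ‖ = 1) {y : (ℝ ∙ ξ)ᗮ}
    (hy : y ∈ Metric.sphere (0 : (ℝ ∙ ξ)ᗮ) 1) (w : ℝ) :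
    (y : EuclideanSpace ℝ (Fin n)) + w • ξ ≠ 0 := by
  intro h
  have h1 := norm_sq_add_smul hξ y w
  rw [h, mem_sphere_zero_iff_norm.1 hy] at h1
  simp at h1
  nlinarith [sq_nonneg w]

theorem norm_add_smul_le_of_mem_sphere (hξ : ‖ξ‖ = 1) {y : (ℝ ∙ ξ)ᗮ}
    (hy : y ∈ Metric.sphere (0 : (ℝ ∙ ξ)ᗮ) 1) (w : ℝ) :
    ‖(y : EuclideanSpace ℝ (Fin n)) + w • ξ‖ ≤ 1 + |w| := by
  refine (norm_add_le _ _).trans ?_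
  have h1 : ‖(y : EuclideanSpace ℝ (Fin n))‖ = 1 := mem_sphere_zero_iff_norm.1 hy
  simp [norm_smul, hξ, h1]

theorem contDiff_add_smul (ξ : EuclideanSpace ℝ (Fin n)) :
    ContDiff ℝ ∞ fun p : (ℝ ∙ ξ)ᗮ × ℝ => (p.1 : EuclideanSpace ℝ (Fin n)) + p.2 • ξ := by
  refine ContDiff.add ?_ (contDiff_snd.smul contDiff_const)
  exact (Submodule.subtypeL (ℝ ∙ ξ)ᗮ).contDiff.comp contDiff_fst

/-- There is a range of slopes `w`, uniform in the direction `θ`, on which `w ρ_K(θ + w ξ)`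
increases with `w`. -/
theorem exists_partialSnd_pos (hK : IsStarBody K) (hξ : ‖ξ‖ = 1) {P : (ℝ ∙ ξ)ᗮ × ℝ → ℝ}
    {U : Set ((ℝ ∙ ξ)ᗮ × ℝ)} (hU : IsOpen U)
    (hPdef : ∀ p, P p = radialFunction K ((p.1 : EuclideanSpace ℝ (Fin n)) + p.2 • ξ))
    (hPs : ContDiffOn ℝ ∞ P U)
    (hSU : ∀ y ∈ Metric.sphere (0 : (ℝ ∙ ξ)ᗮ) 1, ∀ w, (y, w) ∈ U) :
    ∃ δ > 0, ∀ y ∈ Metric.sphere (0 : (ℝ ∙ ξ)ᗮ) 1, ∀ w, |w| ≤ δ →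
      (y, w) ∈ U ∧ 0 < partialSnd (fun p => p.2 * P p) (y, w) := by
  have hZs : ContDiffOn ℝ ∞ (fun p : (ℝ ∙ ξ)ᗮ × ℝ => p.2 * P p) U := contDiffOn_snd.mul hPs
  have hO := (contDiffOn_partialSnd hU hZs).continuousOn.isOpen_inter_preimage hU
    (isOpen_Ioi (a := 0))
  have hsub : Metric.sphere (0 : (ℝ ∙ ξ)ᗮ) 1 ×ˢ {(0 : ℝ)} ⊆
      U ∩ partialSnd (fun p => p.2 * P p) ⁻¹' Set.Ioi 0 := by
    rintro ⟨y, w⟩ ⟨hy, hw⟩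
    obtain rfl : w = 0 := hw
    have hyU := hSU y hy 0
    refine ⟨hyU, ?_⟩
    have h1 := hasDerivAt_partialSnd hU hZs hyU
    have h2 := (hasDerivAt_id (0 : ℝ)).mul (hasDerivAt_partialSnd hU hPs hyU)
    have h3 := h1.unique h2
    simp only [id, zero_mul, one_mul, add_zero] at h3
    rw [Set.mem_preimage, h3, hPdef]
    exact hK.radialFunction_pos (add_smul_ne_zero_of_mem_sphere hξ hy 0)
  obtain ⟨u, v, -, hv, hu1, hv1, huv⟩ :=
    generalized_tube_lemma (isCompact_sphere _ _) isCompact_singleton hO hsub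
  obtain ⟨δ, hδ, hball⟩ := Metric.nhds_basis_closedBall.mem_iff.1 (hv.mem_nhds (hv1 rfl))
  exact ⟨δ, hδ, fun y hy w hw => huv ⟨hu1 hy, hball (by simpa using hw)⟩⟩

/-- Near `z = 0`, on the line `ℝ θ + z ξ` the section is given by `r ≤ ρ_K(θ + w ξ)`, where
`w = w(θ, z)` solves `w ρ_K(θ + w ξ) = z`. In these coordinates `A_ξ(z)` is an integral of smooth
functions over the sphere of `ξ^⊥`. -/
theorem contDiffOn_parallelSection_of_two_le (hK : IsStarBody K) (hsmooth : HasSmoothBoundary K)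
    (hξ : ‖ξ‖ = 1) (hn : 2 ≤ n) :
    ∃ a > 0, ContDiffOn ℝ ∞ (parallelSection K ξ) {z | |z| < a} := by
  have hfin := finrank_orthogonal_add_one hξ
  have : Nontrivial (ℝ ∙ ξ)ᗮ := Module.nontrivial_of_finrank_pos (R := ℝ) (by omega)
  have hne := fun y hy => add_smul_ne_zero_of_mem_sphere hξ (y := y) hy
  obtain ⟨P, hP⟩ : ∃ P : (ℝ ∙ ξ)ᗮ × ℝ → ℝ, ∀ p, P p =
    radialFunction K ((p.1 : EuclideanSpace ℝ (Fin n)) + p.2 • ξ) := ⟨_, fun _ => rfl⟩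
  obtain ⟨U, hUo, hU⟩ : ∃ U : Set ((ℝ ∙ ξ)ᗮ × ℝ), IsOpen U ∧ ∀ p, p ∈ U ↔
      (p.1 : EuclideanSpace ℝ (Fin n)) + p.2 • ξ ≠ 0 :=
    ⟨_, isOpen_compl_singleton.preimage (contDiff_add_smul ξ).continuous, fun _ => Iff.rfl⟩
  have hPs : ContDiffOn ℝ ∞ P U :=
    (hsmooth.contDiffOn.comp (contDiff_add_smul ξ).contDiffOn fun p hp => (hU p).1 hp).congr
      fun p _ => hP p
  have hZs : ContDiffOn ℝ ∞ (fun p : (ℝ ∙ ξ)ᗮ × ℝ => p.2 * P p) U := contDiffOn_snd.mul hPs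
  have hSU : ∀ y ∈ Metric.sphere (0 : (ℝ ∙ ξ)ᗮ) 1, ∀ w, (y, w) ∈ U := fun y hy w =>
    (hU _).2 (hne y hy w)
  obtain ⟨δ, hδ, hpos⟩ := exists_partialSnd_pos hK hξ hUo hP hPs hSU
  obtain ⟨m, hm, M, hM, hbounds⟩ := hK.radialFunction_bounds
  have hPlow : ∀ y ∈ Metric.sphere (0 : (ℝ ∙ ξ)ᗮ) 1, ∀ w, |w| = δ → m / (1 + δ) ≤ P (y, w) := by
    intro y hy w hw
    rw [hP]
    refine le_trans ?_ (hbounds _ (hne y hy w)).1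
    rw [div_eq_mul_inv]
    have h1 := norm_add_smul_le_of_mem_sphere hξ hy w
    rw [hw] at h1
    have h2 := norm_pos_iff.2 (hne y hy w)
    gcongr
  have hends : ∀ y ∈ Metric.sphere (0 : (ℝ ∙ ξ)ᗮ) 1,
      -δ * P (y, -δ) ≤ -(m * δ / (1 + δ)) ∧ m * δ / (1 + δ) ≤ δ * P (y, δ) := by
    intro y hy
    have h1 := hPlow y hy δ (abs_of_pos hδ)
    have h2 := hPlow y hy (-δ) (by rw [abs_neg, abs_of_pos hδ])
    have h3 : m * δ / (1 + δ) = δ * (m / (1 + δ)) := by ring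
    rw [h3]
    constructor <;> nlinarith
  obtain ⟨W, hW, hWc, hWs⟩ := exists_inverse_contDiffOn_integral
    (volume : Measure (ℝ ∙ ξ)ᗮ).toSphere hUo hZs hδ hpos hends
  refine ⟨m * δ / (1 + δ), by positivity, ?_⟩
  refine (hWs (fun p => P p ^ Module.finrank ℝ (ℝ ∙ ξ)ᗮ / Module.finrank ℝ (ℝ ∙ ξ)ᗮ)
    ((hPs.pow _).div_const _)).congr fun z hz => ?_
  have hRm : Measurable fun θ : Metric.sphere (0 : (ℝ ∙ ξ)ᗮ) 1 => P ((θ : (ℝ ∙ ξ)ᗮ), W θ z) :=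
    (hPs.continuousOn.comp_continuous (continuous_subtype_val.prodMk (hWc z hz))
      fun θ => hSU θ θ.2 _).measurable
  have hRpos : ∀ θ : Metric.sphere (0 : (ℝ ∙ ξ)ᗮ) 1, 0 < P ((θ : (ℝ ∙ ξ)ᗮ), W θ z) := fun θ => by
    rw [hP]; exact hK.radialFunction_pos (hne θ θ.2 _)
  refine measureReal_eq_integral_toSphere volume hRm hRpos fun θ r hr => ?_
  have hmono := strictMonoOn_of_partialSnd_pos hUo hZs (hpos θ θ.2)
  obtain ⟨hWδ, hWz⟩ := hW θ z hz
  simp only [hP] at hmono hWz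
  rw [hP]
  exact hK.smul_add_smul_mem_iff hδ (fun x hx => (hbounds x hx).1) (hne θ θ.2)
    (norm_add_smul_le_of_mem_sphere hξ θ.2) hmono hz hWδ hWz hr

theorem exists_contDiffOn_parallelSection (hK : IsStarBody K) (hsmooth : HasSmoothBoundary K)
    (hξ : ‖ξ‖ = 1) : ∃ a > 0, ContDiffOn ℝ ∞ (parallelSection K ξ) {z | |z| < a} := by
  have hfin := finrank_orthogonal_add_one hξ
  rcases Nat.lt_or_ge n 2 with hn | hn
  · -- on a line the sections are points
    have hsub : Subsingleton (ℝ ∙ ξ)ᗮ := Module.finrank_zero_iff (R := ℝ).1 (by omega)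
    have : NeZero n := ⟨by omega⟩
    obtain ⟨m, hm, M, hM, hbounds⟩ := hK.radialFunction_bounds
    refine ⟨m, hm, (contDiffOn_const (c := (volume : Measure (ℝ ∙ ξ)ᗮ).real Set.univ)).congr
      fun z hz => ?_⟩
    have hzK : z • ξ ∈ K := by
      rcases eq_or_ne z 0 with rfl | hz0
      · simpa using hK.zero_mem
      · have hne : z • ξ ≠ 0 := smul_ne_zero hz0 (by rintro rfl; simp at hξ)
        rw [hK.mem_iff hne]
        refine le_trans ?_ (hbounds _ hne).1
        rw [norm_smul, hξ, mul_one, ← div_eq_mul_inv, le_div_iff₀ (norm_pos_iff.2 hz0), one_mul]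
        exact le_of_lt hz
    unfold parallelSection
    congr 1
    ext y
    simp [Subsingleton.elim y 0, hzK]
  · exact contDiffOn_parallelSection_of_two_le hK hsmooth hξ hn

theorem parallelSection_neg (hsymm : ∀ x ∈ K, -x ∈ K) (z : ℝ) :
    parallelSection K ξ (-z) = parallelSection K ξ z := by
  unfold parallelSection
  rw [measureReal_def, measureReal_def, ← Measure.measure_preimage_neg]
  congr 2
  ext y
  have h : ((-y : (ℝ ∙ ξ)ᗮ) : EuclideanSpace ℝ (Fin n)) + -z • ξ = -(y + z • ξ) := by
    simp; abel
  simp only [Set.mem_preimage, Set.mem_ofPred_eq, h]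
  exact ⟨fun h => by simpa using hsymm _ h, fun h => hsymm _ h⟩

theorem measurable_parallelSection (hK : IsCompact K) : Measurable (parallelSection K ξ) := by
  have hc : Continuous fun p : ℝ × (ℝ ∙ ξ)ᗮ => (p.2 : EuclideanSpace ℝ (Fin n)) + p.1 • ξ := by
    fun_prop
  exact (measurable_measure_prodMk_left (hK.isClosed.preimage hc).measurableSet).ennreal_toReal

theorem norm_le_norm_add_smul (hξ : ‖ξ‖ = 1) (y : (ℝ ∙ ξ)ᗮ) (z : ℝ) :
    ‖y‖ ≤ ‖(y : EuclideanSpace ℝ (Fin n)) + z • ξ‖ := by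
  refine abs_le_of_sq_le_sq' ?_ (norm_nonneg _) |>.2
  rw [norm_sq_add_smul hξ]
  nlinarith [sq_nonneg z]

theorem exists_abs_parallelSection_le (hK : IsStarBody K) (hξ : ‖ξ‖ = 1) :
    ∃ C, ∀ z, |parallelSection K ξ z| ≤ C := by
  obtain ⟨R, -, hR⟩ := hK.exists_norm_le
  refine ⟨(volume : Measure (ℝ ∙ ξ)ᗮ).real (Metric.closedBall 0 R), fun z => ?_⟩
  unfold parallelSection
  rw [abs_of_nonneg measureReal_nonneg]
  refine measureReal_mono (fun y hy => ?_) measure_closedBall_lt_top.ne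
  rw [mem_closedBall_zero_iff]
  exact (norm_le_norm_add_smul hξ y z).trans (hR _ hy)

end Sections

/-! ### Smooth functions of the radial function -/

/-- A nonzero nonnegative smooth function on the line that vanishes outside `(1, 2)`. -/
structure IsRadialCutoff (H : ℝ → ℝ) : Prop where
  contDiff : ContDiff ℝ ∞ H
  nonneg : ∀ t, 0 ≤ H t
  eq_zero_of_le_one : ∀ t ≤ 1, H t = 0
  eq_zero_of_two_le : ∀ t, 2 ≤ t → H t = 0
  exists_pos : ∃ t, 0 < H t

theorem exists_isRadialCutoff : ∃ H : ℝ → ℝ, IsRadialCutoff H := by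
  let b : ContDiffBump (3 / 2 : ℝ) := ⟨1 / 4, 1 / 2, by norm_num, by norm_num⟩
  have hz : ∀ t, 1 / 2 ≤ |t - 3 / 2| → b t = 0 := fun t ht =>
    b.zero_of_le_dist (by rw [Real.dist_eq]; exact ht)
  refine ⟨b, b.contDiff, fun t => b.nonneg, fun t ht => hz t ?_, fun t ht => hz t ?_, 3 / 2, ?_⟩
  · rw [abs_sub_comm]; exact (by linarith : (1 : ℝ) / 2 ≤ 3 / 2 - t).trans (le_abs_self _)
  · exact (by linarith : (1 : ℝ) / 2 ≤ t - 3 / 2).trans (le_abs_self _)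
  · exact b.pos_of_mem_ball (by simp [b.rOut_pos])

namespace IsRadialCutoff

variable {H : ℝ → ℝ}

theorem differentiable (hH : IsRadialCutoff H) : Differentiable ℝ H :=
  hH.contDiff.differentiable (by simp)

theorem continuous_deriv (hH : IsRadialCutoff H) : Continuous (deriv H) :=
  hH.contDiff.continuous_deriv (by exact_mod_cast le_top)

/-- The integral of `t^p H(t)` over `(0, ∞)` is finite, as only `1 ≤ t ≤ 2` contributes. -/
theorem integrableOn_zpow_mul (hH : IsRadialCutoff H) (p : ℤ) :
    IntegrableOn (fun t => t ^ p * H t) (Set.Ioi 0) := by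
  have h1 : IntegrableOn (fun t => t ^ p * H t) (Set.Icc 1 2) := by
    refine ContinuousOn.integrableOn_compact isCompact_Icc ?_
    refine ContinuousOn.mul (fun t ht => ?_) hH.contDiff.continuous.continuousOn
    have : t ≠ 0 := by have := ht.1; linarith
    exact (continuousAt_zpow₀ t p (Or.inl this)).continuousWithinAt
  refine (h1.of_forall_sdiff_eq_zero measurableSet_Ioi fun t ht => ?_ :
    IntegrableOn _ (Set.Ioi (0 : ℝ)))
  rcases lt_or_ge t 1 with h | h
  · rw [hH.eq_zero_of_le_one t h.le, mul_zero]
  · have : 2 ≤ t := by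
      by_contra h2
      exact ht.2 ⟨h, (not_le.1 h2).le⟩
    rw [hH.eq_zero_of_two_le t this, mul_zero]

theorem integral_zpow_mul_pos (hH : IsRadialCutoff H) (p : ℤ) :
    0 < ∫ t in Set.Ioi 0, t ^ p * H t := by
  obtain ⟨t₀, ht₀⟩ := hH.exists_pos
  have hpos : ∀ t ∈ Set.Ioi (0 : ℝ), 0 ≤ t ^ p * H t := fun t ht =>
    mul_nonneg (zpow_nonneg (le_of_lt ht) _) (hH.nonneg t)
  rw [setIntegral_pos_iff_support_of_nonneg_ae
    ((ae_restrict_iff' measurableSet_Ioi).2 (Filter.Eventually.of_forall hpos))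
    (hH.integrableOn_zpow_mul p)]
  have hO : IsOpen {t | 0 < H t} := isOpen_lt continuous_const hH.contDiff.continuous
  refine (hO.measure_pos volume ⟨t₀, ht₀⟩).trans_le (measure_mono fun t ht => ?_)
  have ht1 : 1 < t := by
    by_contra h
    have := hH.eq_zero_of_le_one t (not_lt.1 h)
    exact absurd this (ne_of_gt ht)
  have ht0 : (0 : ℝ) < t := by linarith
  exact ⟨(mul_pos (zpow_pos ht0 _) ht).ne', ht0⟩

theorem integral_Ioi_eq_intervalIntegral (hH : IsRadialCutoff H) (p : ℤ) :
    ∫ t in Set.Ioi 0, t ^ p * H t = ∫ t in (1 : ℝ)..2, t ^ p * H t := by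
  rw [intervalIntegral.integral_of_le (by norm_num)]
  refine setIntegral_eq_of_subset_of_forall_sdiff_eq_zero measurableSet_Ioi
    (fun t ht => lt_trans one_pos ht.1) fun t ht => ?_
  rcases le_or_gt t 1 with h | h
  · rw [hH.eq_zero_of_le_one t h, mul_zero]
  · have : 2 ≤ t := by
      by_contra h2
      exact ht.2 ⟨h, (not_le.1 h2).le⟩
    rw [hH.eq_zero_of_two_le t this, mul_zero]

theorem integral_deriv_mul_zpow (hH : IsRadialCutoff H) (p : ℤ) :
    ∫ t in (1 : ℝ)..2, deriv H t * t ^ (p + 1) =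
      -((p : ℝ) + 1) * ∫ t in Set.Ioi 0, t ^ p * H t := by
  rw [hH.integral_Ioi_eq_intervalIntegral]
  have hne : ∀ t ∈ Set.uIcc (1 : ℝ) 2, t ≠ 0 := by
    intro t ht
    rw [Set.uIcc_of_le (by norm_num)] at ht
    have := ht.1
    linarith
  have h := intervalIntegral.integral_mul_deriv_eq_deriv_mul (a := 1) (b := 2)
    (u := fun t : ℝ => t ^ (p + 1)) (v := H) (u' := fun t : ℝ => ((p + 1 : ℤ) : ℝ) * t ^ p)
    (v' := deriv H)
    (fun t ht => by simpa using hasDerivAt_zpow (p + 1) t (Or.inl (hne t ht)))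
    (fun t _ => (hH.differentiable t).hasDerivAt) ?_
    (hH.continuous_deriv.intervalIntegrable _ _)
  · simp only [mul_comm (deriv H _)]
    rw [h, hH.eq_zero_of_le_one 1 le_rfl, hH.eq_zero_of_two_le 2 le_rfl, mul_zero, mul_zero,
      sub_zero, zero_sub, ← intervalIntegral.integral_const_mul, ← intervalIntegral.integral_neg]
    refine intervalIntegral.integral_congr fun t _ => ?_
    push_cast
    ring
  · refine ContinuousOn.intervalIntegrable fun t ht => ?_
    exact (continuousAt_const.mul
      (continuousAt_zpow₀ t p (Or.inl (hne t ht)))).continuousWithinAt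

/-- The fundamental theorem of calculus, cut off at the level `r`. -/
theorem integral_deriv_indicator (hH : IsRadialCutoff H) (r : ℝ) :
    ∫ v in Set.Ioc (1 : ℝ) 2, (Set.Iic r).indicator (deriv H) v = H r := by
  rw [integral_indicator measurableSet_Iic, Measure.restrict_restrict measurableSet_Iic,
    Set.inter_comm, ← Set.Ioi_inter_Iic, Set.inter_assoc, Set.Iic_inter_Iic, Set.Ioi_inter_Iic]
  rcases le_or_gt r 1 with h | h
  · rw [Set.Ioc_eq_empty (by simp [h]), hH.eq_zero_of_le_one r h]
    simp
  · have h1 : 1 ≤ 2 ⊓ r := le_min (by norm_num) h.le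
    rw [← intervalIntegral.integral_of_le h1,
      intervalIntegral.integral_deriv_eq_sub (fun t _ => hH.differentiable t)
        (hH.continuous_deriv.intervalIntegrable _ _), hH.eq_zero_of_le_one 1 le_rfl, sub_zero]
    rcases le_total r 2 with h2 | h2
    · rw [inf_eq_right.2 h2]
    · rw [inf_eq_left.2 h2, hH.eq_zero_of_two_le 2 le_rfl, hH.eq_zero_of_two_le r h2]

end IsRadialCutoff

/-- The function `x ↦ H(ρ_K(x))`. -/
noncomputable def radialProfile {n : ℕ} (K : Set (EuclideanSpace ℝ (Fin n))) (H : ℝ → ℝ)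
    (x : EuclideanSpace ℝ (Fin n)) : ℝ :=
  H (radialFunction K x)

section Profile

variable {n : ℕ} {K : Set (EuclideanSpace ℝ (Fin n))} {ξ : EuclideanSpace ℝ (Fin n)} {H : ℝ → ℝ}

theorem contDiff_radialProfile (hK : IsStarBody K) (hsmooth : HasSmoothBoundary K)
    (hH : IsRadialCutoff H) : ContDiff ℝ ∞ (radialProfile K H) := by
  rw [contDiff_iff_contDiffAt]
  intro x
  rcases eq_or_ne x 0 with rfl | hx
  · obtain ⟨m, hm, M, hM, hb⟩ := hK.radialFunction_bounds
    have : radialProfile K H =ᶠ[nhds 0] fun _ => 0 := by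
      filter_upwards [Metric.ball_mem_nhds (0 : EuclideanSpace ℝ (Fin n)) (half_pos hm)] with x hx
      unfold radialProfile
      rcases eq_or_ne x 0 with rfl | hx0
      · rw [radialFunction_zero, hH.eq_zero_of_le_one 0 zero_le_one]
      · refine hH.eq_zero_of_two_le _ (le_trans ?_ (hb x hx0).1)
        rw [← div_eq_mul_inv, le_div_iff₀ (norm_pos_iff.2 hx0)]
        rw [mem_ball_zero_iff] at hx
        linarith
    exact contDiffAt_const.congr_of_eventuallyEq this
  · exact hH.contDiff.contDiffAt.comp x (hsmooth.contDiffAt hx)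

theorem exists_radialProfile_eq_zero (hK : IsStarBody K) (hH : IsRadialCutoff H) :
    ∃ R, ∀ x, R < ‖x‖ → radialProfile K H x = 0 := by
  obtain ⟨m, hm, M, hM, hb⟩ := hK.radialFunction_bounds
  refine ⟨M, fun x hx => ?_⟩
  have hx0 : 0 < ‖x‖ := hM.trans hx
  refine hH.eq_zero_of_le_one _ ((hb x (norm_pos_iff.1 hx0)).2.trans ?_)
  rw [← div_eq_mul_inv, div_le_one hx0]
  exact hx.le

theorem hasCompactSupport_radialProfile (hK : IsStarBody K) (hH : IsRadialCutoff H) :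
    HasCompactSupport (radialProfile K H) := by
  obtain ⟨R, hR⟩ := exists_radialProfile_eq_zero hK hH
  refine HasCompactSupport.of_support_subset_isCompact
    (isCompact_closedBall (0 : EuclideanSpace ℝ (Fin n)) R) fun x hx => ?_
  rw [mem_closedBall_zero_iff]
  by_contra h
  exact hx (hR x (not_le.1 h))

theorem radialProfile_neg (hsymm : ∀ x ∈ K, -x ∈ K) (x : EuclideanSpace ℝ (Fin n)) :
    radialProfile K H (-x) = radialProfile K H x := by
  rw [radialProfile, radialProfile, radialFunction_neg hsymm]

theorem radialProfile_inv_smul (K : Set (EuclideanSpace ℝ (Fin n))) (H : ℝ → ℝ) {t : ℝ}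
    (ht : 0 < t) (x : EuclideanSpace ℝ (Fin n)) :
    radialProfile K H (t⁻¹ • x) = H (t * radialFunction K x) := by
  rw [radialProfile, radialFunction_smul K (inv_pos.2 ht), inv_inv]

/-- A function of `ρ_K` is a superposition of indicators of dilates of `K`. -/
theorem radialProfile_eq_integral_indicator [NeZero n] (hK : IsStarBody K)
    (hH : IsRadialCutoff H) (x : EuclideanSpace ℝ (Fin n)) :
    radialProfile K H x = ∫ v in Set.Ioc (1 : ℝ) 2, deriv H v * K.indicator 1 (v • x) := by
  have hv0 : ∀ v ∈ Set.Ioc (1 : ℝ) 2, 0 < v := fun v hv => one_pos.trans hv.1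
  rcases eq_or_ne x 0 with rfl | hx
  · -- at the origin `ρ_K` has its default value `0`, and both sides vanish
    rw [radialProfile, radialFunction_zero, hH.eq_zero_of_le_one 0 zero_le_one]
    have h := hH.integral_deriv_indicator 2
    rw [hH.eq_zero_of_two_le 2 le_rfl] at h
    rw [← h]
    refine setIntegral_congr_fun measurableSet_Ioc fun v hv => ?_
    have h2 : v ∈ Set.Iic (2 : ℝ) := hv.2
    simp [hK.zero_mem, h2, -Set.mem_Iic]
  · rw [radialProfile, ← hH.integral_deriv_indicator]
    refine setIntegral_congr_fun measurableSet_Ioc fun v hv => ?_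
    by_cases h : v ≤ radialFunction K x
    · have h1 := (hK.smul_mem_iff hx (hv0 v hv)).2 h
      simp [h, h1]
    · have h1 := mt (hK.smul_mem_iff hx (hv0 v hv)).1 h
      simp [h, h1]

/-- The integral of a function over the hyperplane `ξ^⊥ + z ξ`. -/
noncomputable def sectionIntegral (f : EuclideanSpace ℝ (Fin n) → ℝ)
    (ξ : EuclideanSpace ℝ (Fin n)) (z : ℝ) : ℝ :=
  ∫ y : (ℝ ∙ ξ)ᗮ, f ((y : EuclideanSpace ℝ (Fin n)) + z • ξ)

theorem integral_indicator_smul_section (hK : IsCompact K) (hξ : ‖ξ‖ = 1) {v : ℝ} (hv : 0 < v)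
    (z : ℝ) :
    ∫ y : (ℝ ∙ ξ)ᗮ, K.indicator (1 : EuclideanSpace ℝ (Fin n) → ℝ)
        (v • ((y : EuclideanSpace ℝ (Fin n)) + z • ξ)) =
      (v ^ (n - 1))⁻¹ * parallelSection K ξ (v * z) := by
  have hfin := finrank_orthogonal_add_one hξ
  have h1 : ∀ y : (ℝ ∙ ξ)ᗮ,
      K.indicator (1 : EuclideanSpace ℝ (Fin n) → ℝ)
        (v • ((y : EuclideanSpace ℝ (Fin n)) + z • ξ)) =
      ((fun y : (ℝ ∙ ξ)ᗮ => v • y) ⁻¹'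
        {y | (y : EuclideanSpace ℝ (Fin n)) + (v * z) • ξ ∈ K}).indicator 1 y := by
    intro y
    rw [smul_add, smul_smul]
    simp [Set.indicator]
  simp only [h1]
  rw [integral_indicator_one ((measurableSet_section hK _).preimage (measurable_const_smul v)),
    measureReal_def, Measure.addHaar_preimage_smul _ hv.ne', ENNReal.toReal_mul,
    ENNReal.toReal_ofReal (abs_nonneg _), parallelSection, measureReal_def,
    show Module.finrank ℝ (ℝ ∙ ξ)ᗮ = n - 1 by omega, abs_of_pos (by positivity)]

theorem sectionIntegral_radialProfile [NeZero n] (hK : IsStarBody K) (hH : IsRadialCutoff H)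
    (hξ : ‖ξ‖ = 1) (z : ℝ) :
    sectionIntegral (radialProfile K H) ξ z =
      ∫ v in Set.Ioc (1 : ℝ) 2, deriv H v * (v ^ (n - 1))⁻¹ * parallelSection K ξ (v * z) := by
  obtain ⟨R, -, hR⟩ := hK.exists_norm_le
  unfold sectionIntegral
  simp only [radialProfile_eq_integral_indicator hK hH]
  rw [integral_integral_swap]
  · refine setIntegral_congr_fun measurableSet_Ioc fun v hv => ?_
    rw [integral_const_mul, integral_indicator_smul_section hK.isCompact hξ (one_pos.trans hv.1),
      mul_assoc]
  · have hKm : MeasurableSet K := hK.isCompact.isClosed.measurableSet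
    have hm : Measurable (Function.uncurry fun (y : (ℝ ∙ ξ)ᗮ) (v : ℝ) =>
        deriv H v * K.indicator (1 : EuclideanSpace ℝ (Fin n) → ℝ)
          (v • ((y : EuclideanSpace ℝ (Fin n)) + z • ξ))) := by
      unfold Function.uncurry
      refine (hH.continuous_deriv.measurable.comp measurable_snd).mul ?_
      refine (measurable_one.indicator hKm).comp ?_
      have : Continuous fun p : (ℝ ∙ ξ)ᗮ × ℝ =>
          p.2 • ((p.1 : EuclideanSpace ℝ (Fin n)) + z • ξ) := by fun_prop
      exact this.measurable
    have hi1 : Integrable ((Metric.closedBall (0 : (ℝ ∙ ξ)ᗮ) R).indicator (1 : (ℝ ∙ ξ)ᗮ → ℝ)) :=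
      (integrable_indicator_iff measurableSet_closedBall).2
        (integrableOn_const (C := (1 : ℝ)) (measure_closedBall_lt_top.ne))
    have hi2 : Integrable (deriv H) (volume.restrict (Set.Ioc (1 : ℝ) 2)) :=
      (hH.continuous_deriv.integrableOn_Icc (a := 1) (b := 2)).mono_set Set.Ioc_subset_Icc_self
    refine (hi1.mul_prod hi2.norm).mono' hm.aestronglyMeasurable ?_
    have : ∀ᵐ p : (ℝ ∙ ξ)ᗮ × ℝ ∂(volume.prod (volume.restrict (Set.Ioc (1 : ℝ) 2))),
        p.2 ∈ Set.Ioc (1 : ℝ) 2 :=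
      Measure.quasiMeasurePreserving_snd.ae (ae_restrict_mem measurableSet_Ioc)
    filter_upwards [this] with p hp
    simp only [Function.uncurry]
    rw [norm_mul, mul_comm]
    refine mul_le_mul_of_nonneg_right ?_ (norm_nonneg _)
    by_cases h : p.2 • ((p.1 : EuclideanSpace ℝ (Fin n)) + z • ξ) ∈ K
    · have h1 : p.1 ∈ Metric.closedBall (0 : (ℝ ∙ ξ)ᗮ) R := by
        rw [mem_closedBall_zero_iff]
        refine (norm_le_norm_add_smul hξ p.1 z).trans (le_trans ?_ (hR _ h))
        rw [norm_smul, Real.norm_eq_abs, abs_of_pos (one_pos.trans hp.1)]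
        exact le_mul_of_one_le_left (norm_nonneg _) hp.1.le
      rw [Set.indicator_of_mem h1, Set.indicator_of_mem h]
      simp
    · rw [Set.indicator_of_notMem h, norm_zero]
      exact Set.indicator_nonneg (fun _ _ => zero_le_one) _

end Profile

/-! ### Fubini's theorem for parallel hyperplanes -/

section Slices

variable {n : ℕ} {ξ : EuclideanSpace ℝ (Fin n)}

theorem measurePreserving_add_smul (hξ : ‖ξ‖ = 1) :
    MeasurePreserving fun p : (ℝ ∙ ξ)ᗮ × ℝ => (p.1 : EuclideanSpace ℝ (Fin n)) + p.2 • ξ := by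
  have hfin := finrank_orthogonal_add_one hξ
  let L : WithLp 2 ((ℝ ∙ ξ)ᗮ × ℝ) →ₗᵢ[ℝ] EuclideanSpace ℝ (Fin n) :=
    { toFun := fun p => (p.fst : EuclideanSpace ℝ (Fin n)) + p.snd • ξ
      map_add' := fun p q => by simp only [WithLp.add_fst, WithLp.add_snd, Submodule.coe_add]; module
      map_smul' := fun c p => by
        simp only [WithLp.smul_fst, WithLp.smul_snd, Submodule.coe_smul, RingHom.id_apply,
          smul_eq_mul]
        module
      norm_map' := fun p => by
        refine (sq_eq_sq₀ (norm_nonneg _) (norm_nonneg _)).1 ?_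
        rw [WithLp.prod_norm_sq_eq_of_L2]
        simpa using norm_sq_add_smul hξ p.fst p.snd }
  have hrank : Module.finrank ℝ (WithLp 2 ((ℝ ∙ ξ)ᗮ × ℝ)) =
      Module.finrank ℝ (EuclideanSpace ℝ (Fin n)) := by
    rw [(WithLp.linearEquiv 2 ℝ ((ℝ ∙ ξ)ᗮ × ℝ)).finrank_eq, Module.finrank_prod,
      Module.finrank_self, finrank_euclideanSpace_fin, hfin]
  have h1 := (L.toLinearIsometryEquiv hrank).measurePreserving
  exact h1.comp (WithLp.volume_preserving_toLp (ℝ ∙ ξ)ᗮ ℝ)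

theorem integral_eq_integral_integral_add_smul {F : Type*} [NormedAddCommGroup F]
    [NormedSpace ℝ F] (hξ : ‖ξ‖ = 1) {f : EuclideanSpace ℝ (Fin n) → F} (hf : Integrable f) :
    ∫ x, f x = ∫ z : ℝ, ∫ y : (ℝ ∙ ξ)ᗮ, f ((y : EuclideanSpace ℝ (Fin n)) + z • ξ) := by
  have hmp := measurePreserving_add_smul hξ
  rw [← hmp.map_eq, integral_map hmp.measurable.aemeasurable
    (by rw [hmp.map_eq]; exact hf.aestronglyMeasurable)]
  exact integral_prod_symm _ (hmp.integrable_comp_of_integrable hf)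

theorem continuous_sectionIntegral {f : EuclideanSpace ℝ (Fin n) → ℝ} (hξ : ‖ξ‖ = 1)
    (hf : Continuous f) (hsupp : HasCompactSupport f) : Continuous (sectionIntegral f ξ) := by
  obtain ⟨R, hR⟩ := hsupp.isCompact.isBounded.subset_closedBall 0
  rw [← continuousOn_univ]
  refine continuousOn_integral_of_compact_support
    (f := fun (z : ℝ) (y : (ℝ ∙ ξ)ᗮ) => f ((y : EuclideanSpace ℝ (Fin n)) + z • ξ))
    (isCompact_closedBall (0 : (ℝ ∙ ξ)ᗮ) R) ?_ ?_
  · refine Continuous.continuousOn ?_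
    unfold Function.uncurry
    fun_prop
  · intro z y _ hy
    by_contra h
    have h1 := hR (subset_tsupport f h)
    rw [mem_closedBall_zero_iff] at h1 hy
    exact hy ((norm_le_norm_add_smul hξ y z).trans h1)

theorem integrable_sectionIntegral {f : EuclideanSpace ℝ (Fin n) → ℝ} (hξ : ‖ξ‖ = 1)
    (hf : Integrable f) : Integrable (sectionIntegral f ξ) :=
  ((measurePreserving_add_smul hξ).integrable_comp_of_integrable hf).integral_prod_right

end Slices

/-! ### The Fourier transform of an even function -/

section CosTransform

variable {n : ℕ}

/-- The Fourier transform `∫ f(u) cos⟨u, x⟩ du` of an even function `f`. -/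
noncomputable def cosTransform (f : EuclideanSpace ℝ (Fin n) → ℝ)
    (x : EuclideanSpace ℝ (Fin n)) : ℝ :=
  ∫ u, f u * Real.cos ⟪u, x⟫_ℝ

theorem cosTransform_neg (f : EuclideanSpace ℝ (Fin n) → ℝ) (x : EuclideanSpace ℝ (Fin n)) :
    cosTransform f (-x) = cosTransform f x := by
  simp [cosTransform]

theorem norm_exp_neg_I_mul (a : ℝ) : ‖Complex.exp (-Complex.I * (a : ℂ))‖ = 1 := by
  rw [Complex.norm_exp]; simp

theorem integrable_exp_mul {f : EuclideanSpace ℝ (Fin n) → ℂ} (hf : Integrable f)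
    (x : EuclideanSpace ℝ (Fin n)) :
    Integrable fun y => Complex.exp (-Complex.I * (⟪y, x⟫_ℝ : ℂ)) * f y := by
  refine hf.bdd_mul (c := 1) ?_ (Filter.Eventually.of_forall fun y => ?_)
  · exact (by fun_prop : Continuous fun y : EuclideanSpace ℝ (Fin n) =>
      Complex.exp (-Complex.I * (⟪y, x⟫_ℝ : ℂ))).aestronglyMeasurable
  · rw [norm_exp_neg_I_mul]

theorem integral_exp_mul_eq_cosTransform {f : EuclideanSpace ℝ (Fin n) → ℝ}
    (heven : ∀ x, f (-x) = f x) (hf : Integrable f) (x : EuclideanSpace ℝ (Fin n)) :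
    ∫ y, Complex.exp (-Complex.I * (⟪y, x⟫_ℝ : ℂ)) * (f y : ℂ) = (cosTransform f x : ℂ) := by
  set J := ∫ y, Complex.exp (-Complex.I * (⟪y, x⟫_ℝ : ℂ)) * (f y : ℂ) with hJ
  have h1 : J = ∫ y, Complex.exp (Complex.I * (⟪y, x⟫_ℝ : ℂ)) * (f y : ℂ) := by
    rw [hJ, ← integral_neg_eq_self]
    refine integral_congr_ae (Filter.Eventually.of_forall fun y => ?_)
    simp only [heven, inner_neg_left, Complex.ofReal_neg, neg_mul_neg]
  have hfc : Integrable fun y => (f y : ℂ) := hf.ofReal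
  have hi1 := integrable_exp_mul hfc x
  have hi2 : Integrable fun y => Complex.exp (Complex.I * (⟪y, x⟫_ℝ : ℂ)) * (f y : ℂ) := by
    have := integrable_exp_mul hfc (-x)
    simpa using this
  have h2 : J = (J + J) / 2 := by ring
  have h3 : (cosTransform f x : ℂ) = ∫ y, ((f y * Real.cos ⟪y, x⟫_ℝ : ℝ) : ℂ) :=
    integral_complex_ofReal.symm
  rw [h2]
  nth_rewrite 2 [h1]
  rw [hJ, ← integral_add hi1 hi2, ← integral_div, h3]
  refine integral_congr_ae (Filter.Eventually.of_forall fun y => ?_)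
  simp only [Complex.ofReal_mul, Complex.ofReal_cos, Complex.cos]
  rw [mul_comm (⟪y, x⟫_ℝ : ℂ), neg_mul, neg_mul]
  ring_nf

variable {f : EuclideanSpace ℝ (Fin n) → ℝ} (X : 𝓢(EuclideanSpace ℝ (Fin n), ℂ))

theorem fourierTest_eq_cosTransform (hX : ∀ x, X x = f x) (heven : ∀ x, f (-x) = f x)
    (hf : Integrable f) (x : EuclideanSpace ℝ (Fin n)) :
    fourierTest n X x = (cosTransform f x : ℂ) := by
  rw [fourierTest_apply, ← integral_exp_mul_eq_cosTransform heven hf]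
  simp only [hX]

theorem exists_norm_le_of_schwartz (φ : 𝓢(EuclideanSpace ℝ (Fin n), ℂ)) (N : ℕ) :
    ∃ C, 0 ≤ C ∧ ∀ x, ‖φ x‖ ≤ C * ((1 + ‖x‖) ^ N)⁻¹ := by
  refine ⟨2 ^ N * ((Finset.Iic (N, 0)).sup fun m => SchwartzMap.seminorm ℂ m.1 m.2) φ,
    by positivity, fun x => ?_⟩
  have h := SchwartzMap.one_add_le_sup_seminorm_apply (𝕜 := ℂ) (m := (N, 0)) (k := N) (n := 0)
    le_rfl le_rfl φ x
  rw [norm_iteratedFDeriv_zero] at h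
  rw [← div_eq_mul_inv, le_div_iff₀ (by positivity), mul_comm]
  exact h

theorem exists_abs_cosTransform_le (hX : ∀ x, X x = f x) (heven : ∀ x, f (-x) = f x)
    (hf : Integrable f) (N : ℕ) :
    ∃ C, 0 ≤ C ∧ ∀ x, |cosTransform f x| ≤ C * ((1 + ‖x‖) ^ N)⁻¹ := by
  obtain ⟨C, hC, h⟩ := exists_norm_le_of_schwartz (fourierTest n X) N
  refine ⟨C, hC, fun x => ?_⟩
  have := h x
  rwa [fourierTest_eq_cosTransform X hX heven hf, Complex.norm_real] at this

theorem continuous_cosTransform (hX : ∀ x, X x = f x) (heven : ∀ x, f (-x) = f x)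
    (hf : Integrable f) : Continuous (cosTransform f) := by
  have h : cosTransform f = fun x => (fourierTest n X x).re := by
    ext x; rw [fourierTest_eq_cosTransform X hX heven hf, Complex.ofReal_re]
  rw [h]
  exact Complex.continuous_re.comp (fourierTest n X).continuous

theorem integrable_cosTransform_mul_pow (hX : ∀ x, X x = f x) (heven : ∀ x, f (-x) = f x)
    (hf : Integrable f) {ξ : EuclideanSpace ℝ (Fin n)} (hξ : ‖ξ‖ = 1) (j : ℕ) :
    Integrable fun t : ℝ => cosTransform f (t • ξ) * |t| ^ j := by
  obtain ⟨C, hC, h⟩ := exists_abs_cosTransform_le X hX heven hf (j + 2)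
  have hc := continuous_cosTransform X hX heven hf
  have hi : Integrable fun t : ℝ => C * (1 + ‖t‖) ^ (-(2 : ℝ)) :=
    (integrable_one_add_norm (by simp)).const_mul C
  refine hi.mono' (by fun_prop) (Filter.Eventually.of_forall fun t => ?_)
  have h1 := h (t • ξ)
  rw [norm_smul, hξ, mul_one] at h1
  have h0 : 0 < 1 + ‖t‖ := by positivity
  rw [norm_mul, Real.norm_eq_abs, Real.norm_eq_abs, abs_pow, abs_abs, Real.rpow_neg h0.le]
  calc _ ≤ C * ((1 + ‖t‖) ^ (j + 2))⁻¹ * (1 + ‖t‖) ^ j := by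
        gcongr
        rw [Real.norm_eq_abs]; linarith
    _ = _ := by
        rw [pow_add, ← Real.rpow_natCast _ 2]
        field_simp
        norm_cast

/-- Fourier inversion on the line `ℝ ξ`, on which the Fourier transform of `f` is that of the
integrals of `f` over the hyperplanes orthogonal to `ξ`. -/
theorem sectionIntegral_eq_integral_cosTransform (hX : ∀ x, X x = f x)
    (heven : ∀ x, f (-x) = f x) (hf : Continuous f) (hsupp : HasCompactSupport f)
    {ξ : EuclideanSpace ℝ (Fin n)} (hξ : ‖ξ‖ = 1) (z : ℝ) :
    sectionIntegral f ξ z =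
      ∫ t : ℝ, (2 * Real.pi)⁻¹ * cosTransform f (t • ξ) * Real.cos (|t| * z) := by
  have hfi : Integrable f := hf.integrable_of_hasCompactSupport hsupp
  set B : ℝ → ℂ := fun z => (sectionIntegral f ξ z : ℂ) with hB
  have hBc : Continuous B := Complex.continuous_ofReal.comp (continuous_sectionIntegral hξ hf hsupp)
  have hBi : Integrable B := (integrable_sectionIntegral hξ hfi).ofReal
  have hfc : Integrable fun y => (f y : ℂ) := hfi.ofReal
  have hslice : ∀ w : ℝ, 𝓕 B w = (cosTransform f ((2 * Real.pi * w) • ξ) : ℂ) := by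
    intro w
    rw [Real.fourier_eq', ← integral_exp_mul_eq_cosTransform heven hfi,
      integral_eq_integral_integral_add_smul hξ (integrable_exp_mul hfc _)]
    refine integral_congr_ae (Filter.Eventually.of_forall fun z => ?_)
    simp only [hB, sectionIntegral, smul_eq_mul]
    rw [← integral_complex_ofReal, ← integral_const_mul]
    refine integral_congr_ae (Filter.Eventually.of_forall fun y => ?_)
    have h1 : ⟪(y : EuclideanSpace ℝ (Fin n)) + z • ξ, (2 * Real.pi * w) • ξ⟫_ℝ =
        2 * Real.pi * (z * w) := by
      rw [inner_add_left, real_inner_smul_right, real_inner_smul_left, real_inner_smul_right,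
        real_inner_self_eq_norm_sq, hξ, Submodule.mem_orthogonal_singleton_iff_inner_left.1 y.2]
      ring
    simp only [h1]
    congr 2
    simp
    ring
  have hFi : Integrable (𝓕 B) := by
    have h1 : Integrable fun t : ℝ => cosTransform f (t • ξ) := by
      simpa using integrable_cosTransform_mul_pow X hX heven hfi hξ 0
    have h2 := (h1.comp_mul_left' (R := 2 * Real.pi) (by positivity)).ofReal (𝕜 := ℂ)
    exact h2.congr (Filter.Eventually.of_forall fun w => (hslice w).symm)
  have hinv := congrFun (hBc.fourierInv_fourier_eq hBi hFi) z
  rw [Real.fourierInv_eq'] at hinv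
  have hre := congrArg Complex.re hinv
  have hI : Integrable fun w : ℝ =>
      Complex.exp (↑(2 * Real.pi * ⟪w, z⟫_ℝ) * Complex.I) • 𝓕 B w := by
    refine hFi.bdd_mul (c := 1) ?_ (Filter.Eventually.of_forall fun w => ?_)
    · exact (by fun_prop : Continuous fun w : ℝ =>
        Complex.exp (↑(2 * Real.pi * ⟪w, z⟫_ℝ) * Complex.I)).aestronglyMeasurable
    · rw [Complex.norm_exp_ofReal_mul_I]
  have hswap := integral_re hI
  simp only [RCLike.re_to_complex] at hswap
  rw [← hswap] at hre
  have hBre : (B z).re = sectionIntegral f ξ z := Complex.ofReal_re _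
  rw [hBre] at hre
  have hcomp := Measure.integral_comp_mul_left
    (fun t : ℝ => cosTransform f (t • ξ) * Real.cos (|t| * z)) (2 * Real.pi)
  have h2π : |(2 * Real.pi)⁻¹| = (2 * Real.pi)⁻¹ := abs_of_pos (by positivity)
  rw [h2π, smul_eq_mul, ← integral_const_mul] at hcomp
  simp only [mul_assoc (2 * Real.pi)⁻¹]
  rw [← hcomp, ← hre]
  refine integral_congr_ae (Filter.Eventually.of_forall fun w => ?_)
  simp only [hslice, smul_eq_mul]
  rw [Complex.re_mul_ofReal, Complex.exp_ofReal_mul_I_re, mul_comm]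
  congr 1
  rcases abs_choice (2 * Real.pi * w) with h | h
  · rw [h]; congr 1; simp; ring
  · rw [h, neg_mul, Real.cos_neg]; congr 1; simp; ring

end CosTransform

/-! ### Radial moments of the Fourier transform and derivatives of the section function -/

section Value

variable {n : ℕ} {K : Set (EuclideanSpace ℝ (Fin n))} {ξ : EuclideanSpace ℝ (Fin n)} {H : ℝ → ℝ}

theorem integral_smul_mul_abs_pow (f : EuclideanSpace ℝ (Fin n) → ℝ)
    (ξ : EuclideanSpace ℝ (Fin n)) (k : ℕ) :
    ∫ t : ℝ, (2 * Real.pi)⁻¹ * cosTransform f (t • ξ) * |t| ^ k =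
      Real.pi⁻¹ * ∫ t in Set.Ioi (0 : ℝ), t ^ k * cosTransform f (t • ξ) := by
  have h1 : ∀ t : ℝ, (2 * Real.pi)⁻¹ * cosTransform f (t • ξ) * |t| ^ k =
      (fun t : ℝ => (2 * Real.pi)⁻¹ * (t ^ k * cosTransform f (t • ξ))) |t| := by
    intro t
    have h2 : cosTransform f (|t| • ξ) = cosTransform f (t • ξ) := by
      rcases abs_choice t with h | h
      · rw [h]
      · rw [h, neg_smul, cosTransform_neg]
    simp only [h2]
    ring
  simp only [h1]
  rw [integral_comp_abs (f := fun t : ℝ => (2 * Real.pi)⁻¹ * (t ^ k * cosTransform f (t • ξ))),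
    integral_const_mul]
  field_simp

theorem abs_iteratedDeriv_cos_le (j : ℕ) (v : ℝ) : |iteratedDeriv j Real.cos v| ≤ 1 := by
  obtain ⟨m, rfl | rfl⟩ := Nat.even_or_odd' j
  · rw [Real.iteratedDeriv_even_cos]
    simpa [abs_mul] using Real.abs_cos_le_one v
  · rw [Real.iteratedDeriv_odd_cos]
    simpa [abs_mul] using Real.abs_sin_le_one v

/-- The hyperplane integrals of an even function `f` are a superposition of cosines, weighted by the
Fourier transform of `f` on the line `ℝ ξ`. -/
theorem sectionIntegral_moments (X : 𝓢(EuclideanSpace ℝ (Fin n), ℂ))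
    {f : EuclideanSpace ℝ (Fin n) → ℝ} (hX : ∀ x, X x = f x)
    (heven : ∀ x, f (-x) = f x) (hf : Continuous f) (hsupp : HasCompactSupport f)
    (hξ : ‖ξ‖ = 1) :
    (∀ k, iteratedDeriv k (sectionIntegral f ξ) 0 =
      (Real.pi⁻¹ * ∫ t in Set.Ioi (0 : ℝ), t ^ k * cosTransform f (t • ξ)) *
        iteratedDeriv k Real.cos 0) ∧
    ∀ k, Odd k → ∫ z in Set.Ioi 0, taylorQuotient (sectionIntegral f ξ) k z =
      (Real.pi⁻¹ * ∫ t in Set.Ioi (0 : ℝ), t ^ k * cosTransform f (t • ξ)) *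
        ∫ z in Set.Ioi 0, taylorQuotient Real.cos k z := by
  have hfi : Integrable f := hf.integrable_of_hasCompactSupport hsupp
  have hB : sectionIntegral f ξ = fun z =>
      ∫ t : ℝ, (2 * Real.pi)⁻¹ * cosTransform f (t • ξ) * Real.cos (|t| * z) :=
    funext fun z => sectionIntegral_eq_integral_cosTransform X hX heven hf hsupp hξ z
  have hmom : ∀ j : ℕ, Integrable fun t : ℝ =>
      (2 * Real.pi)⁻¹ * cosTransform f (t • ξ) * |t| ^ j := by
    intro j
    simpa only [mul_assoc] using
      (integrable_cosTransform_mul_pow X hX heven hfi hξ j).const_mul (2 * Real.pi)⁻¹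
  have hd : ∀ j, iteratedDeriv j (sectionIntegral f ξ) 0 =
      (∫ t : ℝ, (2 * Real.pi)⁻¹ * cosTransform f (t • ξ) * |t| ^ j) *
        iteratedDeriv j Real.cos 0 := by
    rw [hB]
    exact iteratedDeriv_superposition (D := Set.univ) (a := 1) (C := fun _ => 1) one_pos
      Real.measurable_cos isOpen_univ Real.contDiff_cos.contDiffOn
      (fun j v _ => abs_iteratedDeriv_cos_le j v) (by fun_prop) hmom (by simp)
  refine ⟨fun k => ?_, fun k hk => ?_⟩
  · rw [hd, integral_smul_mul_abs_pow]
  · have hc := continuous_cosTransform X hX heven hfi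
    rw [← integral_smul_mul_abs_pow]
    refine integral_taylorQuotient_superposition Real.measurable_cos Real.abs_cos_le_one
      (Continuous.measurable (by fun_prop)) (by fun_prop) ?_ hmom (fun z => congrFun hB z) hd
      (integral_taylorQuotient_cos hk).1
    filter_upwards [compl_mem_ae_iff.2 (measure_singleton (0 : ℝ))] with t ht
    exact abs_pos.2 ht

theorem integral_deriv_mul_inv_pow_mul_pow [NeZero n] (hH : IsRadialCutoff H) (k : ℕ) :
    ∫ v in Set.Ioc (1 : ℝ) 2, deriv H v * (v ^ (n - 1))⁻¹ * v ^ k =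
      ((n : ℝ) - k - 1) * ∫ t in Set.Ioi 0, t ^ ((k : ℤ) - n) * H t := by
  have h := hH.integral_deriv_mul_zpow ((k : ℤ) - n)
  rw [intervalIntegral.integral_of_le (by norm_num)] at h
  have h2 : ∫ v in Set.Ioc (1 : ℝ) 2, deriv H v * (v ^ (n - 1))⁻¹ * v ^ k =
      ∫ v in Set.Ioc (1 : ℝ) 2, deriv H v * v ^ ((k : ℤ) - n + 1) := by
    refine setIntegral_congr_fun measurableSet_Ioc fun v hv => ?_
    have hv0 : v ≠ 0 := (one_pos.trans hv.1).ne'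
    have hn : 1 ≤ n := NeZero.one_le
    rw [mul_assoc, ← zpow_natCast v (n - 1), ← zpow_neg, ← zpow_natCast v k, ← zpow_add₀ hv0]
    congr 2
    push_cast [hn]
    ring
  rw [h2, h]
  push_cast
  ring

/-- The hyperplane integrals of `H(ρ_K)` are a superposition of dilates of `A_ξ`. -/
theorem sectionIntegral_radialProfile_moments [NeZero n] (hK : IsStarBody K)
    (hsymm : ∀ x ∈ K, -x ∈ K) (hsmooth : HasSmoothBoundary K) (hH : IsRadialCutoff H)
    (hξ : ‖ξ‖ = 1) :
    (∀ k : ℕ, iteratedDeriv k (sectionIntegral (radialProfile K H) ξ) 0 =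
      (((n : ℝ) - k - 1) * ∫ t in Set.Ioi 0, t ^ ((k : ℤ) - n) * H t) *
        iteratedDeriv k (parallelSection K ξ) 0) ∧
    ∀ k : ℕ, Odd k → IntegrableOn (taylorQuotient (parallelSection K ξ) k) (Set.Ioi 0) ∧
      ∫ z in Set.Ioi 0, taylorQuotient (sectionIntegral (radialProfile K H) ξ) k z =
      (((n : ℝ) - k - 1) * ∫ t in Set.Ioi 0, t ^ ((k : ℤ) - n) * H t) *
        ∫ z in Set.Ioi 0, taylorQuotient (parallelSection K ξ) k z := by
  obtain ⟨a, ha, hA⟩ := exists_contDiffOn_parallelSection hK hsmooth hξ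
  obtain ⟨C, hC⟩ := exists_abs_parallelSection_le hK hξ
  have hAm : Measurable (parallelSection K ξ) := measurable_parallelSection hK.isCompact
  have hOa : IsOpen {z : ℝ | |z| < a} := isOpen_lt continuous_abs continuous_const
  have hOb : IsOpen {z : ℝ | |z| < a / 2} := isOpen_lt continuous_abs continuous_const
  have hsub : {z : ℝ | |z| < a / 2} ⊆ {z | |z| < a} := fun z hz =>
    lt_trans (show |z| < a / 2 from hz) (half_lt_self ha)
  have hB : sectionIntegral (radialProfile K H) ξ = fun z => ∫ v in Set.Ioc (1 : ℝ) 2,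
      deriv H v * (v ^ (n - 1))⁻¹ * parallelSection K ξ (v * z) :=
    funext fun z => sectionIntegral_radialProfile hK hH hξ z
  have hbd : ∀ j, ∃ C, ∀ v ∈ {z : ℝ | |z| < a / 2},
      |iteratedDeriv j (parallelSection K ξ) v| ≤ C := by
    intro j
    have hcpt : IsCompact (Set.Icc (-(a / 2)) (a / 2)) := isCompact_Icc
    have hIcc : Set.Icc (-(a / 2)) (a / 2) ⊆ {z | |z| < a} := fun z hz =>
      lt_of_le_of_lt (abs_le.2 hz) (half_lt_self ha)
    have hcont : ContinuousOn (iteratedDeriv j (parallelSection K ξ)) {z : ℝ | |z| < a} := by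
      have h1 := hA.continuousOn_iteratedDerivWithin (m := j) (natCast_le_infty j)
        hOa.uniqueDiffOn
      refine h1.congr fun z hz => ?_
      exact (iteratedDerivWithin_of_isOpen hOa hz).symm
    obtain ⟨C, hC⟩ := hcpt.exists_bound_of_continuousOn (hcont.mono hIcc)
    exact ⟨C, fun v hv => hC v (abs_le.1 (le_of_lt hv))⟩
  choose C' hC' using hbd
  have hmom : ∀ j : ℕ, Integrable (fun v : ℝ => deriv H v * (v ^ (n - 1))⁻¹ * v ^ j)
      (volume.restrict (Set.Ioc (1 : ℝ) 2)) := by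
    intro j
    refine IntegrableOn.mono_set (t := Set.Icc 1 2) ?_ Set.Ioc_subset_Icc_self
    refine ContinuousOn.integrableOn_compact isCompact_Icc ?_
    refine (hH.continuous_deriv.continuousOn.mul (ContinuousOn.inv₀ (by fun_prop) ?_)).mul
      (by fun_prop)
    intro v hv
    exact pow_ne_zero _ (one_pos.trans_le hv.1).ne'
  have hd : ∀ j : ℕ, iteratedDeriv j (sectionIntegral (radialProfile K H) ξ) 0 =
      (∫ v in Set.Ioc (1 : ℝ) 2, deriv H v * (v ^ (n - 1))⁻¹ * v ^ j) *
        iteratedDeriv j (parallelSection K ξ) 0 := by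
    rw [hB]
    refine iteratedDeriv_superposition (D := {z : ℝ | |z| < a / 2}) (a := a / 4)
      (C := C') (by positivity) hAm hOb (hA.mono hsub) hC' (by fun_prop) hmom ?_
    filter_upwards [ae_restrict_mem measurableSet_Ioc] with v hv z hz
    have hv0 : 0 < v := one_pos.trans hv.1
    rw [abs_mul, abs_of_pos hv0]
    nlinarith [hv.2, abs_nonneg z]
  refine ⟨fun k => ?_, fun k hk => ?_⟩
  · rw [hd, integral_deriv_mul_inv_pow_mul_pow hH]
  · have hq : IntegrableOn (taylorQuotient (parallelSection K ξ) k) (Set.Ioi 0) :=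
      integrableOn_taylorQuotient hAm hC (parallelSection_neg hsymm)
        (hA.contDiffAt (hOa.mem_nhds (by simpa using ha))) hk
    refine ⟨hq, ?_⟩
    rw [← integral_deriv_mul_inv_pow_mul_pow hH]
    refine integral_taylorQuotient_superposition hAm hC
      (hH.continuous_deriv.measurable.mul (by fun_prop)) (by fun_prop) ?_ hmom
      (fun z => congrFun hB z) hd hq
    filter_upwards [ae_restrict_mem measurableSet_Ioc] with v hv using one_pos.trans hv.1

/-- Comparison of the two representations of the hyperplane integrals of `H(ρ_K)`, for even `k`
by their derivatives at `0` and for odd `k` by their regularized integrals. -/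
theorem integral_pow_mul_cosTransform [NeZero n] (hK : IsStarBody K)
    (hsymm : ∀ x ∈ K, -x ∈ K) (hsmooth : HasSmoothBoundary K) (hH : IsRadialCutoff H)
    (hξ : ‖ξ‖ = 1) (k : ℕ) :
    (Even k → ∫ t in Set.Ioi (0 : ℝ), t ^ k * cosTransform (radialProfile K H) (t • ξ) =
      (∫ t in Set.Ioi 0, t ^ ((k : ℤ) - n) * H t) * ((-1) ^ (k / 2) * Real.pi *
        ((n : ℝ) - k - 1) * iteratedDeriv k (parallelSection K ξ) 0)) ∧
    (Odd k → IntegrableOn (taylorQuotient (parallelSection K ξ) k) (Set.Ioi 0) ∧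
      ∫ t in Set.Ioi (0 : ℝ), t ^ k * cosTransform (radialProfile K H) (t • ξ) =
      (∫ t in Set.Ioi 0, t ^ ((k : ℤ) - n) * H t) * ((-1) ^ ((k + 1) / 2) * 2 *
        ((n : ℝ) - 1 - k) * (k.factorial : ℝ) *
        ∫ z in Set.Ioi 0, taylorQuotient (parallelSection K ξ) k z)) := by
  have hχ := contDiff_radialProfile hK hsmooth hH
  have hsupp := hasCompactSupport_radialProfile hK hH
  let X : 𝓢(EuclideanSpace ℝ (Fin n), ℂ) :=
    (hsupp.comp_left Complex.ofReal_zero).toSchwartzMap (Complex.ofRealCLM.contDiff.comp hχ)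
  obtain ⟨h1, h2⟩ := sectionIntegral_moments X (f := radialProfile K H) (fun _ => rfl)
    (radialProfile_neg hsymm) hχ.continuous hsupp hξ
  obtain ⟨h3, h4⟩ := sectionIntegral_radialProfile_moments hK hsymm hsmooth hH hξ
  have hπ := Real.pi_ne_zero
  have hsq : ∀ m : ℕ, ((-1 : ℝ) ^ m) * (-1) ^ m = 1 := fun m => by
    rw [← mul_pow]; simp
  constructor
  · intro hk
    have h5 := (h1 k).symm.trans (h3 k)
    obtain ⟨m, rfl⟩ := hk
    rw [← two_mul] at h5 ⊢
    rw [iteratedDeriv_two_mul_cos_zero] at h5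
    rw [Nat.mul_div_cancel_left m two_pos]
    have h6 := congrArg (fun r => Real.pi * (-1) ^ m * r) h5
    have h7 := hsq m
    generalize (-1 : ℝ) ^ m = e at *
    calc _ = Real.pi * e * (Real.pi⁻¹ * (∫ t in Set.Ioi (0 : ℝ),
          t ^ (2 * m) * cosTransform (radialProfile K H) (t • ξ)) * e) := by
          field_simp
          rw [sq, h7, mul_one]
      _ = _ := by rw [h6]; ring
  · intro hk
    obtain ⟨h5, h6⟩ := h4 k hk
    refine ⟨h5, ?_⟩
    have h7 := (h2 k hk).symm.trans h6
    rw [(integral_taylorQuotient_cos hk).2] at h7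
    have h8 := hsq ((k + 1) / 2)
    generalize (-1 : ℝ) ^ ((k + 1) / 2) = e at *
    have hf : (k.factorial : ℝ) ≠ 0 := by positivity
    calc _ = 2 * e * k.factorial * (Real.pi⁻¹ * (∫ t in Set.Ioi (0 : ℝ),
          t ^ k * cosTransform (radialProfile K H) (t • ξ)) *
            (e * Real.pi / (2 * k.factorial))) := by
          field_simp
          rw [sq, h8, mul_one]
      _ = _ := by rw [h7]; ring

end Value

/-! ### Integrability of powers of the norm and of the radial function -/

section Integrability

variable {n : ℕ} {K : Set (EuclideanSpace ℝ (Fin n))}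

theorem integrableOn_Ioi_pow_mul_inv_one_add_pow (m : ℕ) :
    IntegrableOn (fun s : ℝ => s ^ m * ((1 + s) ^ (m + 2))⁻¹) (Set.Ioi 0) := by
  have hi : IntegrableOn (fun t : ℝ => (1 + ‖t‖) ^ (-(2 : ℝ))) (Set.Ioi 0) :=
    (integrable_one_add_norm (by simp)).integrableOn
  refine Integrable.mono' hi (by fun_prop) ?_
  filter_upwards [ae_restrict_mem measurableSet_Ioi] with s hs
  have hs0 : (0 : ℝ) < s := hs
  have h1 : (0 : ℝ) < 1 + s := by linarith
  rw [Real.norm_of_nonneg hs0.le, Real.norm_of_nonneg (by positivity), Real.rpow_neg h1.le,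
    pow_add]
  calc s ^ m * ((1 + s) ^ m * (1 + s) ^ 2)⁻¹ ≤
      (1 + s) ^ m * ((1 + s) ^ m * (1 + s) ^ 2)⁻¹ := by gcongr; linarith
    _ = ((1 + s) ^ (2 : ℝ))⁻¹ := by
        rw [← Real.rpow_natCast _ 2]
        field_simp
        norm_cast

theorem nontrivial_euclideanSpace [NeZero n] : Nontrivial (EuclideanSpace ℝ (Fin n)) :=
  ⟨⟨EuclideanSpace.single 0 1, 0, by simp⟩⟩

/-- In polar coordinates the function `‖x‖ ^ q` is integrable near the origin for `q > -n`. -/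
theorem integrable_norm_zpow_mul [NeZero n] {q : ℤ} {m : ℕ} (h : (n : ℤ) - 1 + q = m) :
    Integrable fun x : EuclideanSpace ℝ (Fin n) => ‖x‖ ^ q * ((1 + ‖x‖) ^ (m + 2))⁻¹ := by
  have := nontrivial_euclideanSpace (n := n)
  refine (integrable_fun_norm_addHaar (volume : Measure (EuclideanSpace ℝ (Fin n)))
    (f := fun r : ℝ => r ^ q * ((1 + r) ^ (m + 2))⁻¹)).2 ?_
  refine (integrableOn_Ioi_pow_mul_inv_one_add_pow m).congr_fun (fun s hs => ?_) measurableSet_Ioi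
  have hs0 : s ≠ 0 := (show (0 : ℝ) < s from hs).ne'
  have hn : 1 ≤ n := NeZero.one_le
  simp only [finrank_euclideanSpace_fin, smul_eq_mul]
  rw [← mul_assoc, ← zpow_natCast s (n - 1), ← zpow_add₀ hs0, ← zpow_natCast s m, ← h]
  push_cast [hn]
  rfl

theorem integrable_norm_zpow_mul_norm_schwartz [NeZero n] {q : ℤ} (h : 0 ≤ (n : ℤ) - 1 + q)
    (φ : 𝓢(EuclideanSpace ℝ (Fin n), ℂ)) :
    Integrable fun x : EuclideanSpace ℝ (Fin n) => ‖x‖ ^ q * ‖φ x‖ := by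
  obtain ⟨m, hm⟩ := Int.eq_ofNat_of_zero_le h
  obtain ⟨C, hC, hφ⟩ := exists_norm_le_of_schwartz φ (m + 2)
  have hc := φ.continuous
  refine ((integrable_norm_zpow_mul hm).const_mul C).mono'
    ((measurable_norm.pow_const q).aestronglyMeasurable.mul hc.norm.aestronglyMeasurable)
    (Filter.Eventually.of_forall fun x => ?_)
  have h0 : 0 ≤ ‖x‖ ^ q := zpow_nonneg (norm_nonneg x) _
  rw [Real.norm_of_nonneg (by positivity)]
  calc _ ≤ ‖x‖ ^ q * (C * ((1 + ‖x‖) ^ (m + 2))⁻¹) := by gcongr; exact hφ x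
    _ = _ := by ring

theorem IsStarBody.exists_radialFunction_zpow_le [NeZero n] (hK : IsStarBody K) (p : ℤ) :
    ∃ C, 0 ≤ C ∧ ∀ x, x ≠ 0 → radialFunction K x ^ p ≤ C * ‖x‖ ^ (-p) := by
  obtain ⟨m, hm, M, hM, hb⟩ := hK.radialFunction_bounds
  refine ⟨m ^ p + M ^ p, by positivity, fun x hx => ?_⟩
  have hx0 := norm_pos_iff.2 hx
  obtain ⟨h1, h2⟩ := hb x hx
  have hρ := hK.radialFunction_pos hx
  have hinv : ∀ c : ℝ, c ^ p * ‖x‖ ^ (-p) = (c * ‖x‖⁻¹) ^ p := fun c => by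
    rw [mul_zpow, inv_zpow, zpow_neg]
  rw [add_mul, hinv, hinv]
  have h3 : 0 < (m * ‖x‖⁻¹) ^ p := by positivity
  have h4 : 0 < (M * ‖x‖⁻¹) ^ p := by positivity
  rcases le_total 0 p with hp | hp
  · exact (zpow_le_zpow_left₀ hp hρ.le h2).trans (by linarith)
  · refine le_trans ?_ (by linarith : (m * ‖x‖⁻¹) ^ p ≤ _)
    obtain ⟨q, rfl⟩ : ∃ q, p = -q := ⟨-p, by ring⟩
    rw [zpow_neg, zpow_neg]
    exact inv_anti₀ (by positivity) (zpow_le_zpow_left₀ (by linarith) (by positivity) h1)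

theorem measurable_radialFunction_zpow (hsmooth : HasSmoothBoundary K) (p : ℤ) :
    Measurable fun x => radialFunction K x ^ p :=
  hsmooth.measurable.pow_const p

theorem integrable_radialFunction_zpow_mul [NeZero n] (hK : IsStarBody K)
    (hsmooth : HasSmoothBoundary K) (k : ℕ) {ψ : EuclideanSpace ℝ (Fin n) → ℝ}
    (hψ : AEStronglyMeasurable ψ)
    (hi : Integrable fun x => ‖x‖ ^ ((k : ℤ) + 1 - n) * |ψ x|) :
    Integrable fun x => radialFunction K x ^ ((n : ℤ) - k - 1) * ψ x := by
  have := nontrivial_euclideanSpace (n := n)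
  obtain ⟨C, hC, h⟩ := hK.exists_radialFunction_zpow_le ((n : ℤ) - k - 1)
  refine (hi.const_mul C).mono'
    ((measurable_radialFunction_zpow hsmooth _).aestronglyMeasurable.mul hψ) ?_
  filter_upwards [compl_mem_ae_iff.2 (measure_singleton (0 : EuclideanSpace ℝ (Fin n)))] with x hx
  have h1 := h x hx
  rw [show -((n : ℤ) - k - 1) = (k : ℤ) + 1 - n by ring] at h1
  rw [norm_mul, Real.norm_of_nonneg (zpow_nonneg (hK.radialFunction_nonneg x) _),
    Real.norm_eq_abs, ← mul_assoc]
  exact mul_le_mul_of_nonneg_right h1 (abs_nonneg _)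

theorem integrable_radialFunction_zpow_mul_schwartz [NeZero n] (hK : IsStarBody K)
    (hsmooth : HasSmoothBoundary K) (k : ℕ) (φ : 𝓢(EuclideanSpace ℝ (Fin n), ℂ)) :
    Integrable fun x => ((radialFunction K x ^ ((n : ℤ) - k - 1) : ℝ) : ℂ) * φ x := by
  have hc := φ.continuous
  have h := integrable_radialFunction_zpow_mul hK hsmooth k (ψ := fun x => ‖φ x‖)
    (by fun_prop)
    (by simpa using integrable_norm_zpow_mul_norm_schwartz (q := (k : ℤ) + 1 - n) (by omega) φ)
  refine h.mono ?_ (Filter.Eventually.of_forall fun x => ?_)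
  · exact (Complex.measurable_ofReal.comp
      (measurable_radialFunction_zpow hsmooth _)).aestronglyMeasurable.mul
        hc.aestronglyMeasurable
  · simp

/-- The tempered distribution given by integration against `ρ_K ^ (n - k - 1)`. -/
theorem exists_isGivenBy_radialFunction_zpow [NeZero n] (hK : IsStarBody K)
    (hsmooth : HasSmoothBoundary K) (k : ℕ) :
    ∃ T : 𝓢'(EuclideanSpace ℝ (Fin n), ℂ),
      IsGivenBy T fun x => radialFunction K x ^ ((n : ℤ) - k - 1) := by
  have hf := measurable_radialFunction_zpow hsmooth ((n : ℤ) - k - 1)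
  have hf0 : ∀ x, 0 ≤ radialFunction K x ^ ((n : ℤ) - k - 1) := fun x =>
    zpow_nonneg (hK.radialFunction_nonneg x) _
  set μ : Measure (EuclideanSpace ℝ (Fin n)) :=
    volume.withDensity fun x => ENNReal.ofReal (radialFunction K x ^ ((n : ℤ) - k - 1)) with hμ
  have hgrowth : μ.HasTemperateGrowth := by
    refine ⟨k + 2, ?_⟩
    rw [hμ, integrable_withDensity_iff hf.ennreal_ofReal (by simp)]
    have h := integrable_radialFunction_zpow_mul hK hsmooth k
      (ψ := fun x => (1 + ‖x‖) ^ (-((k + 2 : ℕ) : ℝ)))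
      (Measurable.aestronglyMeasurable (by fun_prop)) ?_
    · simpa only [ENNReal.toReal_ofReal (hf0 _), mul_comm] using h
    · refine (integrable_norm_zpow_mul (n := n) (q := (k : ℤ) + 1 - n) (m := k) (by ring)).congr
        (Filter.Eventually.of_forall fun x => ?_)
      have h0 : (0 : ℝ) < 1 + ‖x‖ := by positivity
      simp only
      rw [abs_of_nonneg (by positivity), Real.rpow_neg h0.le, Real.rpow_natCast]
  refine ⟨μ.toTemperedDistribution, fun φ =>
    ⟨integrable_radialFunction_zpow_mul_schwartz hK hsmooth k φ, ?_⟩⟩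
  change ∫ x, φ x ∂μ = _
  rw [hμ, integral_withDensity_eq_integral_toReal_smul hf.ennreal_ofReal (by simp)]
  refine integral_congr_ae (Filter.Eventually.of_forall fun x => ?_)
  simp only [ENNReal.toReal_ofReal (hf0 x), Complex.real_smul]

end Integrability

/-! ### The Fourier transform of a power of the radial function -/

section Transform

variable {n : ℕ} {K : Set (EuclideanSpace ℝ (Fin n))} {H : ℝ → ℝ}

/-- The power `ρ_K ^ (n - k - 1)` is a superposition of dilates of `H(ρ_K)`. -/
theorem integral_zpow_mul_radialProfile (hK : IsStarBody K) (hH : IsRadialCutoff H) (k : ℕ)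
    {x : EuclideanSpace ℝ (Fin n)} (hx : x ≠ 0) :
    IntegrableOn (fun t : ℝ => t ^ ((k : ℤ) - n) * radialProfile K H (t⁻¹ • x)) (Set.Ioi 0) ∧
    ∫ t in Set.Ioi (0 : ℝ), t ^ ((k : ℤ) - n) * radialProfile K H (t⁻¹ • x) =
      (∫ t in Set.Ioi 0, t ^ ((k : ℤ) - n) * H t) * radialFunction K x ^ ((n : ℤ) - k - 1) := by
  have hρ := hK.radialFunction_pos hx
  have h1 : ∀ t ∈ Set.Ioi (0 : ℝ), radialFunction K x ^ ((n : ℤ) - k) *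
      (fun v => v ^ ((k : ℤ) - n) * H v) (radialFunction K x * t) =
      t ^ ((k : ℤ) - n) * radialProfile K H (t⁻¹ • x) := by
    intro t ht
    have h2 : radialFunction K x ^ ((n : ℤ) - k) * radialFunction K x ^ ((k : ℤ) - n) = 1 := by
      rw [← zpow_add₀ hρ.ne', sub_add_sub_cancel, sub_self, zpow_zero]
    simp only
    rw [radialProfile_inv_smul K H ht, mul_zpow, mul_comm t]
    linear_combination (t ^ ((k : ℤ) - n) * H (radialFunction K x * t)) * h2
  constructor
  · refine IntegrableOn.congr_fun (Integrable.const_mul ?_ _) h1 measurableSet_Ioi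
    exact (integrableOn_Ioi_comp_mul_left_iff (fun v => v ^ ((k : ℤ) - n) * H v) 0 hρ).2
      (by simpa using hH.integrableOn_zpow_mul _)
  · have h3 := integral_comp_mul_left_Ioi (fun v => v ^ ((k : ℤ) - n) * H v) 0 hρ
    rw [mul_zero, smul_eq_mul] at h3
    rw [← setIntegral_congr_fun measurableSet_Ioi h1, integral_const_mul, h3,
      zpow_sub_one₀ hρ.ne']
    ring

/-- The multiplication formula for a dilate of an even function. -/
theorem integral_inv_smul_mul_fourierTest {f : EuclideanSpace ℝ (Fin n) → ℝ}
    (heven : ∀ x, f (-x) = f x) (hf : Integrable f) (φ : 𝓢(EuclideanSpace ℝ (Fin n), ℂ))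
    {t : ℝ} (ht : 0 < t) :
    ∫ x, (f (t⁻¹ • x) : ℂ) * fourierTest n φ x =
      ∫ y, ((t ^ n * cosTransform f (t • y) : ℝ) : ℂ) * φ y := by
  have hft : Integrable fun x => f (t⁻¹ • x) := hf.comp_smul (inv_ne_zero ht.ne')
  have hftc : Integrable fun x => (f (t⁻¹ • x) : ℂ) := hft.ofReal
  have hcos : ∀ y, cosTransform (fun x => f (t⁻¹ • x)) y = t ^ n * cosTransform f (t • y) := by
    intro y
    have h := Measure.integral_comp_inv_smul_of_nonneg volume
      (fun u => f u * Real.cos ⟪u, t • y⟫_ℝ) ht.le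
    rw [finrank_euclideanSpace_fin, smul_eq_mul] at h
    rw [cosTransform, cosTransform, ← h]
    refine integral_congr_ae (Filter.Eventually.of_forall fun x => ?_)
    simp only [real_inner_smul_left, real_inner_smul_right]
    rw [mul_inv_cancel_left₀ ht.ne']
  calc _ = ∫ x, ∫ y, (f (t⁻¹ • x) : ℂ) *
        (Complex.exp (-Complex.I * (⟪y, x⟫_ℝ : ℂ)) * φ y) := by
        refine integral_congr_ae (Filter.Eventually.of_forall fun x => ?_)
        simp only
        rw [fourierTest_apply, integral_const_mul]
    _ = ∫ y, ∫ x, (f (t⁻¹ • x) : ℂ) * (Complex.exp (-Complex.I * (⟪y, x⟫_ℝ : ℂ)) * φ y) := by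
        refine integral_integral_swap ?_
        have hexp : Continuous fun p : EuclideanSpace ℝ (Fin n) × EuclideanSpace ℝ (Fin n) =>
            Complex.exp (-Complex.I * (⟪p.2, p.1⟫_ℝ : ℂ)) := by fun_prop
        refine ((hftc.mul_prod φ.integrable).bdd_mul (c := 1) hexp.aestronglyMeasurable
          (Filter.Eventually.of_forall fun p => by rw [norm_exp_neg_I_mul])).congr
          (Filter.Eventually.of_forall fun p => ?_)
        simp only [Function.uncurry]
        ring
    _ = _ := by
        refine integral_congr_ae (Filter.Eventually.of_forall fun y => ?_)
        simp only
        rw [← hcos, ← integral_exp_mul_eq_cosTransform (fun x => by rw [smul_neg, heven]) hft,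
          ← integral_mul_const]
        refine integral_congr_ae (Filter.Eventually.of_forall fun x => ?_)
        simp only [real_inner_comm]
        ring

/-- The function `y ↦ c⁻¹ ∫₀^∞ t ^ k f̂(t y) dt` with `c = ∫₀^∞ t ^ (k - n) H(t) dt` and
`f = H(ρ_K)`. -/
noncomputable def transformFunction (K : Set (EuclideanSpace ℝ (Fin n))) (H : ℝ → ℝ) (k : ℕ)
    (y : EuclideanSpace ℝ (Fin n)) : ℝ :=
  (∫ t in Set.Ioi 0, t ^ ((k : ℤ) - n) * H t)⁻¹ *
    ∫ t in Set.Ioi (0 : ℝ), t ^ k * cosTransform (radialProfile K H) (t • y)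

section Decay

variable {f : EuclideanSpace ℝ (Fin n) → ℝ} {k : ℕ} {C : ℝ}

theorem pow_mul_abs_le_of_decay (hf : ∀ x, |f x| ≤ C * ((1 + ‖x‖) ^ (k + 2))⁻¹) {r : ℝ}
    (hr : 0 < r) (hC : 0 ≤ C) {y : EuclideanSpace ℝ (Fin n)} (hy : r ≤ ‖y‖) {t : ℝ}
    (ht : 0 < t) :
    ‖t ^ k * f (t • y)‖ ≤ C * (r ^ k)⁻¹ * ((r * t) ^ k * ((1 + r * t) ^ (k + 2))⁻¹) := by
  have h := hf (t • y)
  rw [norm_smul, Real.norm_of_nonneg ht.le] at h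
  rw [norm_mul, Real.norm_of_nonneg (pow_pos ht k).le, Real.norm_eq_abs]
  calc _ ≤ t ^ k * (C * ((1 + t * r) ^ (k + 2))⁻¹) := by
        refine mul_le_mul_of_nonneg_left (h.trans ?_) (pow_pos ht k).le
        gcongr
    _ = _ := by rw [mul_pow, mul_comm t r]; field_simp

theorem integrableOn_decay_bound {r : ℝ} (hr : 0 < r) (c : ℝ) :
    IntegrableOn (fun t : ℝ => c * ((r * t) ^ k * ((1 + r * t) ^ (k + 2))⁻¹)) (Set.Ioi 0) := by
  refine Integrable.const_mul ?_ c
  exact (integrableOn_Ioi_comp_mul_left_iff (fun s : ℝ => s ^ k * ((1 + s) ^ (k + 2))⁻¹) 0 hr).2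
    (by simpa using integrableOn_Ioi_pow_mul_inv_one_add_pow k)

theorem integrableOn_pow_mul_of_decay (hcont : Continuous f) (hC : 0 ≤ C)
    (hf : ∀ x, |f x| ≤ C * ((1 + ‖x‖) ^ (k + 2))⁻¹) {y : EuclideanSpace ℝ (Fin n)} (hy : y ≠ 0) :
    IntegrableOn (fun t : ℝ => t ^ k * f (t • y)) (Set.Ioi 0) ∧
    ∫ t in Set.Ioi (0 : ℝ), ‖t ^ k * f (t • y)‖ ≤
      (C * ∫ s in Set.Ioi (0 : ℝ), s ^ k * ((1 + s) ^ (k + 2))⁻¹) * ‖y‖ ^ (-((k : ℤ) + 1)) := by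
  have hy0 := norm_pos_iff.2 hy
  have hb := integrableOn_decay_bound (k := k) hy0 (C * (‖y‖ ^ k)⁻¹)
  have hle : ∀ᵐ t ∂(volume.restrict (Set.Ioi (0 : ℝ))), ‖t ^ k * f (t • y)‖ ≤
      C * (‖y‖ ^ k)⁻¹ * ((‖y‖ * t) ^ k * ((1 + ‖y‖ * t) ^ (k + 2))⁻¹) := by
    filter_upwards [ae_restrict_mem measurableSet_Ioi] with t ht
    exact pow_mul_abs_le_of_decay hf hy0 hC le_rfl ht
  have hi : IntegrableOn (fun t : ℝ => t ^ k * f (t • y)) (Set.Ioi 0) :=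
    hb.mono' (Continuous.aestronglyMeasurable (by fun_prop)) hle
  refine ⟨hi, (integral_mono_ae hi.norm hb hle).trans ?_⟩
  have h3 := integral_comp_mul_left_Ioi (fun s : ℝ => s ^ k * ((1 + s) ^ (k + 2))⁻¹) 0 hy0
  rw [mul_zero, smul_eq_mul] at h3
  rw [integral_const_mul, h3, zpow_neg, zpow_add_one₀ hy0.ne', zpow_natCast, mul_inv]
  apply le_of_eq
  ring

theorem continuousAt_integral_pow_mul_of_decay (hcont : Continuous f) (hC : 0 ≤ C)
    (hf : ∀ x, |f x| ≤ C * ((1 + ‖x‖) ^ (k + 2))⁻¹) {y : EuclideanSpace ℝ (Fin n)} (hy : y ≠ 0) :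
    ContinuousAt (fun y => ∫ t in Set.Ioi (0 : ℝ), t ^ k * f (t • y)) y := by
  have hr : 0 < ‖y‖ / 2 := half_pos (norm_pos_iff.2 hy)
  refine continuousAt_of_dominated (bound := fun t => C * ((‖y‖ / 2) ^ k)⁻¹ *
    ((‖y‖ / 2 * t) ^ k * ((1 + ‖y‖ / 2 * t) ^ (k + 2))⁻¹)) ?_ ?_ (integrableOn_decay_bound hr _) ?_
  · exact Filter.Eventually.of_forall fun y => Continuous.aestronglyMeasurable (by fun_prop)
  · have : ∀ᶠ x in nhds y, ‖y‖ / 2 < ‖x‖ :=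
      continuous_norm.continuousAt.eventually_const_lt (half_lt_self (norm_pos_iff.2 hy))
    filter_upwards [this] with x hx
    filter_upwards [ae_restrict_mem measurableSet_Ioi] with t ht
    exact pow_mul_abs_le_of_decay hf hr hC hx.le ht
  · exact Filter.Eventually.of_forall fun t => by fun_prop

end Decay

theorem integrable_smul_prod_of_decay [NeZero n] {f : EuclideanSpace ℝ (Fin n) → ℝ} {k : ℕ} {C : ℝ}
    (hcont : Continuous f) (hC : 0 ≤ C) (hf : ∀ x, |f x| ≤ C * ((1 + ‖x‖) ^ (k + 2))⁻¹)
    {φ : EuclideanSpace ℝ (Fin n) → ℂ} (hφ : Continuous φ)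
    (hi : Integrable fun y => ‖y‖ ^ (-((k : ℤ) + 1)) * ‖φ y‖) :
    Integrable (Function.uncurry fun (y : EuclideanSpace ℝ (Fin n)) (t : ℝ) =>
      ((t ^ k * f (t • y) : ℝ) : ℂ) * φ y) (volume.prod (volume.restrict (Set.Ioi 0))) := by
  have := nontrivial_euclideanSpace (n := n)
  have hmeas : Continuous (Function.uncurry fun (y : EuclideanSpace ℝ (Fin n)) (t : ℝ) =>
      ((t ^ k * f (t • y) : ℝ) : ℂ) * φ y) := by
    unfold Function.uncurry
    fun_prop
  have hne : ∀ᵐ y : EuclideanSpace ℝ (Fin n), y ≠ 0 :=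
    compl_mem_ae_iff.2 (measure_singleton (0 : EuclideanSpace ℝ (Fin n)))
  rw [integrable_prod_iff hmeas.aestronglyMeasurable]
  constructor
  · filter_upwards [hne] with y hy
    exact ((integrableOn_pow_mul_of_decay hcont hC hf hy).1.ofReal (𝕜 := ℂ)).mul_const (φ y)
  · refine (hi.const_mul (C * ∫ s in Set.Ioi (0 : ℝ), s ^ k * ((1 + s) ^ (k + 2))⁻¹)).mono'
      hmeas.aestronglyMeasurable.norm.integral_prod_right' ?_
    filter_upwards [hne] with y hy
    rw [Real.norm_of_nonneg (integral_nonneg fun t => norm_nonneg _)]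
    simp only [Function.uncurry, norm_mul, Complex.norm_real, integral_mul_const]
    rw [← mul_assoc]
    refine mul_le_mul_of_nonneg_right ?_ (norm_nonneg _)
    simpa only [norm_mul] using (integrableOn_pow_mul_of_decay hcont hC hf hy).2

theorem integral_norm_zpow_mul_radialProfile (hK : IsStarBody K) (hH : IsRadialCutoff H) (k : ℕ)
    {x : EuclideanSpace ℝ (Fin n)} (hx : x ≠ 0) :
    ∫ t in Set.Ioi (0 : ℝ), ‖t ^ ((k : ℤ) - n) * radialProfile K H (t⁻¹ • x)‖ =
      (∫ t in Set.Ioi 0, t ^ ((k : ℤ) - n) * H t) * radialFunction K x ^ ((n : ℤ) - k - 1) := by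
  rw [← (integral_zpow_mul_radialProfile hK hH k hx).2]
  refine setIntegral_congr_fun measurableSet_Ioi fun t ht => ?_
  have ht0 : (0 : ℝ) < t := ht
  exact Real.norm_of_nonneg (mul_nonneg (zpow_pos ht0 _).le (hH.nonneg _))

theorem integrable_radialProfile_smul_prod [NeZero n] (hK : IsStarBody K)
    (hsmooth : HasSmoothBoundary K) (hH : IsRadialCutoff H) (k : ℕ)
    (ψ : 𝓢(EuclideanSpace ℝ (Fin n), ℂ)) :
    Integrable (Function.uncurry fun (x : EuclideanSpace ℝ (Fin n)) (t : ℝ) =>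
      ((t ^ ((k : ℤ) - n) * radialProfile K H (t⁻¹ • x) : ℝ) : ℂ) * ψ x)
      (volume.prod (volume.restrict (Set.Ioi 0))) := by
  have := nontrivial_euclideanSpace (n := n)
  have hne : ∀ᵐ y : EuclideanSpace ℝ (Fin n), y ≠ 0 :=
    compl_mem_ae_iff.2 (measure_singleton (0 : EuclideanSpace ℝ (Fin n)))
  have hχ : Measurable (radialProfile K H) :=
    (contDiff_radialProfile hK hsmooth hH).continuous.measurable
  have hfi := integrable_radialFunction_zpow_mul_schwartz hK hsmooth k ψ
  have hm1 : Measurable fun p : EuclideanSpace ℝ (Fin n) × ℝ =>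
      p.2 ^ ((k : ℤ) - n) * radialProfile K H (p.2⁻¹ • p.1) :=
    (measurable_snd.pow_const _).mul (hχ.comp (measurable_snd.inv.smul measurable_fst))
  have hm : Measurable (Function.uncurry fun (x : EuclideanSpace ℝ (Fin n)) (t : ℝ) =>
      ((t ^ ((k : ℤ) - n) * radialProfile K H (t⁻¹ • x) : ℝ) : ℂ) * ψ x) :=
    (Complex.measurable_ofReal.comp hm1).mul (ψ.continuous.measurable.comp measurable_fst)
  rw [integrable_prod_iff hm.aestronglyMeasurable]
  constructor
  · filter_upwards [hne] with x hx
    exact ((integral_zpow_mul_radialProfile hK hH k hx).1.ofReal (𝕜 := ℂ)).mul_const (ψ x)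
  · refine (hfi.norm.const_mul (∫ t in Set.Ioi 0, t ^ ((k : ℤ) - n) * H t)).congr ?_
    filter_upwards [hne] with x hx
    simp only [Function.uncurry]
    simp only [norm_mul (Complex.ofReal _), Complex.norm_real, integral_mul_const]
    rw [integral_norm_zpow_mul_radialProfile hK hH k hx,
      Real.norm_of_nonneg (zpow_nonneg (hK.radialFunction_nonneg x) _), mul_assoc]

/-- The Fourier transform of `ρ_K ^ (n - k - 1)` is the function `transformFunction K H k`, tested
against functions `φ` for which `|y| ^ (-k-1) φ(y)` is integrable. -/
theorem integral_radialFunction_zpow_mul_fourierTest [NeZero n] (hK : IsStarBody K)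
    (hsymm : ∀ x ∈ K, -x ∈ K) (hsmooth : HasSmoothBoundary K) (hH : IsRadialCutoff H) (k : ℕ)
    (φ : 𝓢(EuclideanSpace ℝ (Fin n), ℂ))
    (hi : Integrable fun y => ‖y‖ ^ (-((k : ℤ) + 1)) * ‖φ y‖) :
    Integrable (fun y => (transformFunction K H k y : ℂ) * φ y) ∧
    ∫ x, ((radialFunction K x ^ ((n : ℤ) - k - 1) : ℝ) : ℂ) * fourierTest n φ x =
      ∫ y, (transformFunction K H k y : ℂ) * φ y := by
  have := nontrivial_euclideanSpace (n := n)
  have hne : ∀ᵐ y : EuclideanSpace ℝ (Fin n), y ≠ 0 :=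
    compl_mem_ae_iff.2 (measure_singleton (0 : EuclideanSpace ℝ (Fin n)))
  have hχ := contDiff_radialProfile hK hsmooth hH
  have hsupp := hasCompactSupport_radialProfile hK hH
  have heven := radialProfile_neg (H := H) hsymm
  have hχi : Integrable (radialProfile K H) := hχ.continuous.integrable_of_hasCompactSupport hsupp
  let X : 𝓢(EuclideanSpace ℝ (Fin n), ℂ) :=
    (hsupp.comp_left Complex.ofReal_zero).toSchwartzMap (Complex.ofRealCLM.contDiff.comp hχ)
  have hcont := continuous_cosTransform X (fun _ => rfl) heven hχi
  obtain ⟨C, hC, hdecay⟩ := exists_abs_cosTransform_le X (fun _ => rfl) heven hχi (k + 2)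
  set c := ∫ t in Set.Ioi 0, t ^ ((k : ℤ) - n) * H t with hc
  have hc0 : c ≠ 0 := (hH.integral_zpow_mul_pos _).ne'
  have hcC : (c : ℂ) ≠ 0 := by exact_mod_cast hc0
  have hprod := integrable_smul_prod_of_decay hcont hC hdecay φ.continuous hi
  have hg : ∀ y, (transformFunction K H k y : ℂ) * φ y = (c : ℂ)⁻¹ * ∫ t in Set.Ioi (0 : ℝ),
      ((t ^ k * cosTransform (radialProfile K H) (t • y) : ℝ) : ℂ) * φ y := by
    intro y
    rw [integral_mul_const, integral_complex_ofReal, transformFunction, ← hc]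
    push_cast
    ring
  refine ⟨?_, ?_⟩
  · simp only [hg]
    exact hprod.integral_prod_left.const_mul _
  have hf : ∀ᵐ x : EuclideanSpace ℝ (Fin n),
      ((radialFunction K x ^ ((n : ℤ) - k - 1) : ℝ) : ℂ) * fourierTest n φ x =
      (c : ℂ)⁻¹ * ∫ t in Set.Ioi (0 : ℝ),
        ((t ^ ((k : ℤ) - n) * radialProfile K H (t⁻¹ • x) : ℝ) : ℂ) * fourierTest n φ x := by
    filter_upwards [hne] with x hx
    rw [integral_mul_const, integral_complex_ofReal,
      (integral_zpow_mul_radialProfile hK hH k hx).2, ← hc]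
    push_cast
    field_simp
  have hswap := integrable_radialProfile_smul_prod hK hsmooth hH k (fourierTest n φ)
  rw [integral_congr_ae hf, integral_const_mul, integral_integral_swap hswap]
  simp only [hg]
  rw [integral_const_mul, integral_integral_swap hprod]
  congr 1
  refine setIntegral_congr_fun measurableSet_Ioi fun t ht => ?_
  have ht0 : (0 : ℝ) < t := ht
  have h1 := integral_inv_smul_mul_fourierTest heven hχi φ ht0
  have h2 : t ^ ((k : ℤ) - n) * t ^ n = t ^ k := by
    rw [← zpow_natCast t n, ← zpow_add₀ ht0.ne', sub_add_cancel, zpow_natCast]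
  simp only [Complex.ofReal_mul (t ^ ((k : ℤ) - n)), mul_assoc]
  rw [integral_const_mul, h1, ← integral_const_mul]
  refine integral_congr_ae (Filter.Eventually.of_forall fun y => ?_)
  simp only [← h2]
  push_cast
  ring

theorem continuousOn_transformFunction (hK : IsStarBody K)
    (hsymm : ∀ x ∈ K, -x ∈ K) (hsmooth : HasSmoothBoundary K) (hH : IsRadialCutoff H) (k : ℕ) :
    ContinuousOn (transformFunction K H k) {0}ᶜ := by
  have hχ := contDiff_radialProfile hK hsmooth hH
  have hsupp := hasCompactSupport_radialProfile hK hH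
  have heven := radialProfile_neg (H := H) hsymm
  have hχi : Integrable (radialProfile K H) := hχ.continuous.integrable_of_hasCompactSupport hsupp
  let X : 𝓢(EuclideanSpace ℝ (Fin n), ℂ) :=
    (hsupp.comp_left Complex.ofReal_zero).toSchwartzMap (Complex.ofRealCLM.contDiff.comp hχ)
  have hcont := continuous_cosTransform X (fun _ => rfl) heven hχi
  obtain ⟨C, hC, hdecay⟩ := exists_abs_cosTransform_le X (fun _ => rfl) heven hχi (k + 2)
  exact fun y hy => (continuousAt_const.mul
    (continuousAt_integral_pow_mul_of_decay hcont hC hdecay hy)).continuousWithinAt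

theorem integrable_norm_zpow_mul_of_notMem_tsupport (q : ℤ)
    (φ : 𝓢(EuclideanSpace ℝ (Fin n), ℂ)) (hφ : (0 : EuclideanSpace ℝ (Fin n)) ∉ tsupport φ)
    (hq : q ≤ 0) : Integrable fun y => ‖y‖ ^ q * ‖φ y‖ := by
  obtain ⟨ε, hε, hball⟩ := Metric.isOpen_iff.1 (isClosed_tsupport φ).isOpen_compl 0 hφ
  refine (φ.integrable.norm.const_mul (ε ^ q)).mono'
    ((measurable_norm.pow_const q).aestronglyMeasurable.mul
      φ.continuous.norm.aestronglyMeasurable) (Filter.Eventually.of_forall fun y => ?_)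
  rw [Real.norm_of_nonneg (by positivity)]
  rcases lt_or_ge ‖y‖ ε with h | h
  · have : φ y = 0 := image_eq_zero_of_notMem_tsupport (hball (mem_ball_zero_iff.2 h))
    simp [this]
  · refine mul_le_mul_of_nonneg_right ?_ (norm_nonneg _)
    obtain ⟨p, rfl⟩ : ∃ p, q = -p := ⟨-q, by ring⟩
    rw [zpow_neg, zpow_neg]
    exact inv_anti₀ (by positivity) (zpow_le_zpow_left₀ (by omega) hε.le h)

end Transform
end StarBody

theorem theorem1 (n k : ℕ) (hk : k + 1 ≠ n) (K : Set (EuclideanSpace ℝ (Fin n)))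
    (hK : StarBody.IsStarBody K) (hsymm : ∀ x ∈ K, -x ∈ K)
    (hsmooth : StarBody.HasSmoothBoundary K) :
    ∃ T : 𝓢'(EuclideanSpace ℝ (Fin n), ℂ),
      StarBody.IsGivenBy T (fun x => StarBody.radialFunction K x ^ ((n : ℤ) - k - 1)) ∧
      ∃ g : EuclideanSpace ℝ (Fin n) → ℝ,
        ContinuousOn g {0}ᶜ ∧
        StarBody.IsGivenByOffZero (StarBody.fourierDistribution T) g ∧
        (k + 1 < n → StarBody.IsGivenBy (StarBody.fourierDistribution T) g) ∧
        ∀ ξ : EuclideanSpace ℝ (Fin n), ‖ξ‖ = 1 →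
          ContDiffAt ℝ ∞ (StarBody.parallelSection K ξ) 0 ∧
          (Even k →
            g ξ = (-1) ^ (k / 2) * Real.pi * ((n : ℝ) - k - 1) *
              iteratedDeriv k (StarBody.parallelSection K ξ) 0) ∧
          (Odd k →
            IntegrableOn (fun z : ℝ =>
              (StarBody.parallelSection K ξ z - ∑ j ∈ Finset.range ((k + 1) / 2),
                iteratedDeriv (2 * j) (StarBody.parallelSection K ξ) 0 *
                  z ^ (2 * j) / ((2 * j).factorial : ℝ)) / z ^ (k + 1)) (Set.Ioi 0) ∧
            g ξ = (-1) ^ ((k + 1) / 2) * 2 * ((n : ℝ) - 1 - k) * (k.factorial : ℝ) *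
              ∫ z in Set.Ioi (0 : ℝ),
                (StarBody.parallelSection K ξ z - ∑ j ∈ Finset.range ((k + 1) / 2),
                  iteratedDeriv (2 * j) (StarBody.parallelSection K ξ) 0 *
                    z ^ (2 * j) / ((2 * j).factorial : ℝ)) / z ^ (k + 1)) := by
  rcases Nat.eq_zero_or_pos n with rfl | hn
  · -- in dimension zero the radial function vanishes and there are no unit vectors
    refine ⟨0, fun φ => ?_, 0, continuousOn_const, fun φ _ => ?_, fun h => absurd h (by omega),
      fun ξ hξ => ?_⟩
    · have h : ∀ x : EuclideanSpace ℝ (Fin 0),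
          StarBody.radialFunction K x ^ (((0 : ℕ) : ℤ) - k - 1) = 0 := fun x => by
        rw [Subsingleton.elim x 0, StarBody.radialFunction_zero, zero_zpow _ (by omega)]
      simp only [h]
      simp
    · simp [StarBody.fourierDistribution_apply]
    · rw [Subsingleton.elim ξ 0, norm_zero] at hξ
      exact absurd hξ zero_ne_one
  · have : NeZero n := ⟨hn.ne'⟩
    obtain ⟨H, hH⟩ := StarBody.exists_isRadialCutoff
    obtain ⟨T, hT⟩ := StarBody.exists_isGivenBy_radialFunction_zpow hK hsmooth k
    have hmain : ∀ φ : 𝓢(EuclideanSpace ℝ (Fin n), ℂ),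
        Integrable (fun y => ‖y‖ ^ (-((k : ℤ) + 1)) * ‖φ y‖) →
        Integrable (fun y => (StarBody.transformFunction K H k y : ℂ) * φ y) ∧
        StarBody.fourierDistribution T φ =
          ∫ y, (StarBody.transformFunction K H k y : ℂ) * φ y := by
      intro φ hφ
      have h := StarBody.integral_radialFunction_zpow_mul_fourierTest hK hsymm hsmooth hH k φ hφ
      refine ⟨h.1, ?_⟩
      rw [StarBody.fourierDistribution_apply, (hT _).2, h.2]
    refine ⟨T, hT, StarBody.transformFunction K H k,
      StarBody.continuousOn_transformFunction hK hsymm hsmooth hH k,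
      fun φ hφ => hmain φ (StarBody.integrable_norm_zpow_mul_of_notMem_tsupport _ φ hφ (by omega)),
      fun hkn φ => hmain φ
        (StarBody.integrable_norm_zpow_mul_norm_schwartz (q := -((k : ℤ) + 1)) (by omega) φ),
      fun ξ hξ => ?_⟩
    obtain ⟨a, ha, hA⟩ := StarBody.exists_contDiffOn_parallelSection hK hsmooth hξ
    have hc := (hH.integral_zpow_mul_pos ((k : ℤ) - n)).ne'
    obtain ⟨heven, hodd⟩ := StarBody.integral_pow_mul_cosTransform hK hsymm hsmooth hH hξ k
    refine ⟨hA.contDiffAt ((isOpen_lt continuous_abs continuous_const).mem_nhds (by simpa using ha)),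
      fun h => ?_, fun h => ⟨(hodd h).1, ?_⟩⟩
    · rw [StarBody.transformFunction, heven h, inv_mul_cancel_left₀ hc]
    · rw [StarBody.transformFunction, (hodd h).2, inv_mul_cancel_left₀ hc]
      rfl
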